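/- Let $X$ be a real Hilbert space with norm $\|\cdot\|$ and scalar product $\langle\cdot,\cdot\rangle$, and let $U$ be a separable real Hilbert space. Let $A$ be the generator of a compact strongly continuous semigroup $(e^{At})_{t\ge 0}$ on $X$ (that is, $e^{At}$ is a compact operator for every $t>0$), let $g:X\to X$ be Lipschitz on bounded subsets of $X$, and let $h:U\to X$ be a bounded linear operator. Suppose that there are constants $\omega\in(0,\infty)$, $C\in\mathbb{R}$ and $\omega'\in(-\infty,\omega)$ such that $$\|e^{At}\|\le e^{-\omega t}\quad(t\ge 0)\qquad\text{and}\qquad \langle x,g(x)\rangle\le C+\omega'\|x\|^2\quad(x\in X).$$ Let $0\le r_0<\infty$ and let $$\mathcal{U}:=\{u\in S^\infty(\mathbb{R}_0^+,U):\ \|u\|_{\infty}\le r_0\},$$ where $S^\infty(\mathbb{R}_0^+,U)$ is the set of those $u\in L^\infty(\mathbb{R}_0^+,U)$ for which there are compactly supported step functions $u_n:\mathbb{R}_0^+\to U$ (each constant on finitely many open intervals $(t_{i-1},t_i)$, $0=t_0<\dots<t_m$, and zero on $(t_m,\infty)$) with $u_n\to u$ in $L^\infty([0,b],U)$ for every $b>0$.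 Then the following holds. 1. The maximal mild solutions of $\dot x=Ax+g(x)+hu(t)$ with $u\in\mathcal{U}$ generate a semiprocess family $(S_u)_{u\in\mathcal{U}}$. That is, for all $u\in\mathcal{U}$, $s\ge 0$, $x_s\in X$ there is a unique maximal mild solution with $x(s)=x_s$, i.e. a unique continuous solution, defined on a maximal interval $[s,\tau)$, of $$x(t)=e^{A(t-s)}x_s+\int_s^t e^{A(t-r)}\big(g(x(r))+hu(r)\big)\,dr ;$$ it exists globally ($\tau=\infty$); and $S_u(t,s,x_s):=x(t)$ for $t\ge s$ satisfies $S_u(s,s,x)=x$, $S_u(t,s,S_u(s,r,x))=S_u(t,r,x)$ for $t\ge s\ge r\ge 0$, and $S_u(t+\eta,s+\eta,x)=S_{u(\cdot+\eta)}(t,s,x)$ for $t\ge s\ge 0$, $\eta\ge 0$, where $u(\cdot+\eta)\in\mathcal{U}$ for all $u\in\mathcal{U}$, $\eta\ge0$. 2. The undisturbed semiprocess $S_{\{0\}}$ has a unique global attractor $\Theta$, i.e. there is a unique compact set $\Theta\subset X$ such that, with $\operatorname{dist}(x,\Theta)=\inf_{\theta\in\Theta}\|x-\theta\|$ (and $\inf\emptyset=\infty$),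 $\sup_{x\in B}\operatorname{dist}(S_0(t,0,x),\Theta)\to 0$ as $t\to\infty$ for every bounded $B\subset X$, and $\Theta\subset S_0(t,0,\Theta)$ for every $t\ge 0$. 3. The family $(S_u)_{u\in\mathcal{U}}$ is of asymptotic gain with respect to $\Theta$: there is a continuous, strictly increasing function $\gamma:[0,\infty)\to[0,\infty)$ with $\gamma(0)=0$ such that $$\limsup_{t\to\infty}\operatorname{dist}\big(S_u(t,0,x_0),\Theta\big)\le\gamma(\|u\|_\infty)\qquad\text{for all }x_0\in X,\ u\in\mathcal{U}.$$ -/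

import Mathlib

open MeasureTheory Filter Topology Set
open scoped NNReal ENNReal

namespace AsympGain

/-! ### Semigroups, their generators, and mild solutions -/

section Semigroup

variable {X : Type*} [NormedAddCommGroup X] [NormedSpace ℝ X]

/-- A strongly continuous semigroup of bounded linear operators on `X`. -/
structure C0Semigroup (X : Type*) [NormedAddCommGroup X] [NormedSpace ℝ X] where
  /-- The operator at time `t`. -/
  op : ℝ≥0 → X →L[ℝ] X
  op_zero : op 0 = ContinuousLinearMap.id ℝ X
  op_add : ∀ s t, op (s + t) = (op s).comp (op t)
  continuous_orbit : ∀ x, Continuous fun t => op t x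

/-- The (possibly unbounded) operator `A` is the generator of `E`, that is, `x ∈ D(A)` with
`A x = y` if and only if `(E(t) x - x) / t → y` as `t → 0+`. Then `E(t) = e^{At}`. -/
def C0Semigroup.IsGeneratedBy (E : C0Semigroup X) (A : X →ₗ.[ℝ] X) : Prop :=
  ∀ x y : X, (x, y) ∈ A.graph ↔
    Tendsto (fun t : ℝ≥0 => (t : ℝ)⁻¹ • (E.op t x - x)) (𝓝[>] 0) (𝓝 y)

/-- An (immediately) compact semigroup: `E(t)` is a compact operator for every `t > 0`. -/
def C0Semigroup.IsCompactSemigroup (E : C0Semigroup X) : Prop :=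
  ∀ t : ℝ≥0, 0 < t → IsCompactOperator (E.op t)

/-- `g` is Lipschitz on every bounded subset of `X`. -/
def LipschitzOnBounded (g : X → X) : Prop :=
  ∀ B : Set X, Bornology.IsBounded B → ∃ L : ℝ≥0, LipschitzOnWith L g B

variable {U : Type*} [NormedAddCommGroup U] [NormedSpace ℝ U]

/-- The real half-open interval `[s, τ)`, where `τ = ∞` is allowed. -/
def timeInterval (s : ℝ) (τ : EReal) : Set ℝ := {t | s ≤ t ∧ (t : EReal) < τ}

/-- `x` is a mild solution on `[s, τ)` of `x' = A x + g(x) + h v`, `x(s) = xs`, where `A`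
generates `E`: it is continuous and satisfies
`x(t) = E(t-s) xs + ∫_s^t E(t-r) (g(x(r)) + h v(r)) dr` on `[s, τ)`. -/
structure IsMildSolution (E : C0Semigroup X) (g : X → X) (h : U →L[ℝ] X) (v : ℝ → U)
    (s : ℝ) (xs : X) (τ : EReal) (x : ℝ → X) : Prop where
  lt : (s : EReal) < τ
  continuousOn : ContinuousOn x (timeInterval s τ)
  intervalIntegrable : ∀ t ∈ timeInterval s τ,
    IntervalIntegrable (fun r => E.op (t - r).toNNReal (g (x r) + h (v r))) volume s t
  eq : ∀ t ∈ timeInterval s τ,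
    x t = E.op (t - s).toNNReal xs + ∫ r in s..t, E.op (t - r).toNNReal (g (x r) + h (v r))

/-- `x` is a maximal mild solution on `[s, τ)`: it cannot be extended to a mild solution on
a strictly larger interval `[s, τ')`. -/
structure IsMaximalMildSolution (E : C0Semigroup X) (g : X → X) (h : U →L[ℝ] X) (v : ℝ → U)
    (s : ℝ) (xs : X) (τ : EReal) (x : ℝ → X) : Prop where
  isMildSolution : IsMildSolution E g h v s xs τ x
  maximal : ∀ (τ' : EReal) (y : ℝ → X), IsMildSolution E g h v s xs τ' y → τ ≤ τ' →
    EqOn y x (timeInterval s τ) → τ' = τ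

end Semigroup

/-! ### Input spaces -/

section Inputs

/-- Lebesgue measure on `[0, ∞)`. -/
noncomputable abbrev halfLine : Measure ℝ := volume.restrict (Ici 0)

variable {U : Type*} [NormedAddCommGroup U]

/-- The space `L^∞([0, ∞), U)`, of classes of functions modulo equality almost everywhere. -/
noncomputable abbrev LInfty (U : Type*) [NormedAddCommGroup U] := Lp U ∞ halfLine

lemma measurePreserving_add_halfLine (h : ℝ≥0) :
    MeasurePreserving (fun t : ℝ => t + h) halfLine (volume.restrict (Ici (h : ℝ))) := by
  have := (measurePreserving_add_right (volume : Measure ℝ) (h : ℝ)).restrict_preimage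
    (s := Ici (h : ℝ)) measurableSet_Ici
  simpa using this

lemma memLp_shift (h : ℝ≥0) (u : LInfty U) :
    MemLp (fun t : ℝ => u (t + h)) ∞ halfLine :=
  ((Lp.memLp u).mono_measure (Measure.restrict_mono_set _
    (Ici_subset_Ici.2 h.coe_nonneg))).comp_measurePreserving (measurePreserving_add_halfLine h)

/-- The left translation `T(h) u = u(· + h)`. -/
noncomputable def shift (h : ℝ≥0) (u : LInfty U) : LInfty U := (memLp_shift h u).toLp

lemma coeFn_shift (h : ℝ≥0) (u : LInfty U) :
    shift h u =ᵐ[halfLine] fun t : ℝ => u (t + h) := (memLp_shift h u).coeFn_toLp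

/-- `f` is, on `[0, ∞)`, a step function with compact support: there are finitely many points
`0 = t 0 < t 1 < ... < t m` such that `f` is constant on each `(t i, t (i+1))` and vanishes on
`(t m, ∞)`. -/
def IsCompactStep (f : ℝ → U) : Prop :=
  ∃ (m : ℕ) (t : Fin (m + 1) → ℝ), StrictMono t ∧ t 0 = 0 ∧
    (∀ i : Fin m, ∃ c : U, ∀ r ∈ Ioo (t i.castSucc) (t i.succ), f r = c) ∧
    ∀ r ∈ Ioi (t (Fin.last m)), f r = 0

/-- The set `S^∞([0, ∞), U)` of those `u ∈ L^∞([0, ∞), U)` that are limits in `L^∞_loc` of a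
sequence of compactly supported step functions. -/
def SInfty (U : Type*) [NormedAddCommGroup U] : Set (LInfty U) :=
  {u | ∃ f : ℕ → ℝ → U, (∀ n, IsCompactStep (f n)) ∧
    ∀ t₀ : ℝ, 0 < t₀ →
      Tendsto (fun n => eLpNorm (fun r => f n r - u r) ∞ (volume.restrict (Icc 0 t₀)))
        atTop (𝓝 0)}

/-- The input space `S^∞([0, ∞), U)` intersected with the closed `L^∞`-ball of radius `r₀`. -/
def inputSpace (U : Type*) [NormedAddCommGroup U] (r₀ : ℝ) : Set (LInfty U) :=
  SInfty U ∩ Metric.closedBall 0 r₀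

end Inputs

/-! ### Semiprocess families, attractors, asymptotic gain -/

section Semiprocess

variable {X V : Type*}

/-- `(S v)` for `v ∈ 𝒱` is a semiprocess family on `X` with input space `𝒱` and translation `T`.
Only the values `S v t s x` with `v ∈ 𝒱` and `t ≥ s ≥ 0` are relevant. -/
structure IsSemiprocessFamily (𝒱 : Set V) (T : ℝ≥0 → V → V) (S : V → ℝ → ℝ → X → X) :
    Prop where
  mapsTo : ∀ h, MapsTo (T h) 𝒱 𝒱
  refl : ∀ v ∈ 𝒱, ∀ s x, 0 ≤ s → S v s s x = x
  trans : ∀ v ∈ 𝒱, ∀ r s t x, 0 ≤ r → r ≤ s → s ≤ t → S v t s (S v s r x) = S v t r x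
  translate : ∀ v ∈ 𝒱, ∀ (h : ℝ≥0) (s t : ℝ) (x : X), 0 ≤ s → s ≤ t →
    S v (t + h) (s + h) x = S (T h v) t s x

/-- The set-valued semiprocess `S_𝒱(t, s, M)`. -/
def setSemiprocess (S : V → ℝ → ℝ → X → X) (𝒱 : Set V) (t s : ℝ) (M : Set X) : Set X :=
  {y | ∃ v ∈ 𝒱, ∃ x ∈ M, S v t s x = y}

variable [NormedAddCommGroup X]

/-- The Hausdorff semi-distance `sup_{x ∈ M} inf_{θ ∈ Θ} ‖x - θ‖`, with values in `[0, ∞]` and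
`inf ∅ = ∞`. -/
noncomputable def semiDist (M Θ : Set X) : ℝ≥0∞ := ⨆ x ∈ M, Metric.infEDist x Θ

/-- `Θ` is a global attractor of the set-valued semiprocess `S_𝒱`. -/
structure IsGlobalAttractor (S : V → ℝ → ℝ → X → X) (𝒱 : Set V) (Θ : Set X) : Prop where
  isCompact : IsCompact Θ
  attractive : ∀ B : Set X, Bornology.IsBounded B →
    Tendsto (fun t : ℝ => semiDist (setSemiprocess S 𝒱 t 0 B) Θ) atTop (𝓝 0)
  negInvariant : ∀ t : ℝ, 0 ≤ t → Θ ⊆ setSemiprocess S 𝒱 t 0 Θ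

/-- The class `𝒦` of comparison functions. -/
structure IsClassK (γ : ℝ≥0 → ℝ≥0) : Prop where
  continuous : Continuous γ
  strictMono : StrictMono γ
  map_zero : γ 0 = 0

/-- The asymptotic gain property with respect to `Θ`:
`limsup_{t → ∞} dist(S_u(t, 0, x₀), Θ) ≤ γ(‖u‖_∞)` for all `x₀` and all inputs `u ∈ 𝒰`, with one
comparison function `γ ∈ 𝒦`. -/
def HasAsymptoticGain [NormedAddCommGroup V] (S : V → ℝ → ℝ → X → X) (𝒰 : Set V)
    (Θ : Set X) : Prop :=
  ∃ γ : ℝ≥0 → ℝ≥0, IsClassK γ ∧ ∀ (x₀ : X), ∀ u ∈ 𝒰,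
    limsup (fun t : ℝ => Metric.infEDist (S u t 0 x₀) Θ) atTop ≤ (γ ‖u‖₊ : ℝ≥0∞)

/-- The maximal mild solutions of `x' = A x + g(x) + h u`, `u ∈ 𝒰`, where `A` generates `E`, are
given by `S`: for every `u ∈ 𝒰`, every initial time `s ≥ 0` and every initial state `xs`, the
curve `S u · s xs` is a maximal mild solution on `[s, ∞)` (so it exists globally in time), and it
is the only maximal mild solution. -/
def GivenByMildSolutions {U : Type*} [NormedAddCommGroup U] [NormedSpace ℝ U] [NormedSpace ℝ X]
    (E : C0Semigroup X) (g : X → X) (h : U →L[ℝ] X) (𝒰 : Set (LInfty U))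
    (S : LInfty U → ℝ → ℝ → X → X) : Prop :=
  ∀ u ∈ 𝒰, ∀ s : ℝ, 0 ≤ s → ∀ xs : X,
    IsMaximalMildSolution E g h u s xs ⊤ (fun t => S u t s xs) ∧
    ∀ (τ : EReal) (y : ℝ → X), IsMaximalMildSolution E g h u s xs τ y →
      τ = ⊤ ∧ ∀ t, s ≤ t → y t = S u t s xs

end Semiprocess

end AsympGain

/-!
The theorem rests on one energy estimate. For a mild solution of `x' = A x + g(x) + w` with
`‖w‖ ≤ M`, the variation of constants formula on `[t, z]` gives
`‖x(z)‖² ≤ e^{-2ω(z-t)} ‖x(t)‖² + 2 (z-t) (⟨x(t), g(x(t))⟩ + M ‖x(t)‖) + o(z-t)` as `z ↓ t`, which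
bounds the upper right Dini derivative of `‖x‖²` (`IsSol.eventually_slope_norm_sq_lt`). No
regularity of `x` and no approximation by classical solutions is needed. Comparison with the scalar
equation `φ' = -(ω - ω') φ + const` then yields `IsSol.norm_sq_le`: trajectories exist globally and
enter, uniformly for bounded sets of initial values, a ball whose radius depends only on `M`.

* Existence: truncating `g` outside a large ball gives a bounded, globally Lipschitz map, for which
  Picard iteration in a weighted space of bounded continuous functions solves the equation on the
  whole half-line (`exists_isSol_of_lipschitzWith`); by the energy estimate the truncation is not
  felt (`exists_isSol`). Uniqueness and Lipschitz dependence on the data follow from Gronwall's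
  inequality (`IsSol.norm_sub_le`).
* Attractor: `x(1) = E(ε) x(1-ε) + O(ε)` uniformly on bounded sets, so the undisturbed solution map
  at time `1` is compact (`IsDissipative.exists_compact_sol_one`), and the `ω`-limit set of the
  absorbing ball is the global attractor (`exists_compact_attracting`).
* Asymptotic gain: restart a disturbed trajectory in the absorbing ball and run it for a fixed time
  `T` in which the undisturbed flow brings this ball `ε/2`-close to the attractor. By Lipschitz
  dependence on the disturbance, the two trajectories differ by at most `k_T ‖h‖ ‖u‖`, hence the
  asymptotic distance to the attractor is at most `ε` for small `‖u‖`
  (`IsDissipative.exists_limsup_le`). As it is also bounded, a comparison function exists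
  (`exists_isClassK`).
-/

namespace AsympGain

/-! ### Contraction semigroups and the convolution integral -/

section Convolution

variable {X : Type*} [NormedAddCommGroup X] [NormedSpace ℝ X]

/-- The convolution `∫_s^t E(t-r) f(r) dr`. -/
noncomputable def C0Semigroup.conv (E : C0Semigroup X) (f : ℝ → X) (s t : ℝ) : X :=
  ∫ r in s..t, E.op (t - r).toNNReal (f r)

variable {E : C0Semigroup X} {f f' : ℝ → X} {s t b M : ℝ}

lemma C0Semigroup.norm_op_apply_le (hE : ∀ t, ‖E.op t‖ ≤ 1) (t : ℝ≥0) (x : X) :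
    ‖E.op t x‖ ≤ ‖x‖ := by
  simpa using (E.op t).le_of_opNorm_le (hE t) x

/-- A contraction semigroup is jointly continuous in time and state. -/
lemma C0Semigroup.continuous_op_uncurry (hE : ∀ t, ‖E.op t‖ ≤ 1) :
    Continuous fun p : ℝ≥0 × X => E.op p.1 p.2 := by
  rw [continuous_iff_continuousAt]
  rintro ⟨t₀, x₀⟩
  have h1 : Tendsto (fun p : ℝ≥0 × X => ‖p.2 - x₀‖ + ‖E.op p.1 x₀ - E.op t₀ x₀‖)
      (𝓝 (t₀, x₀)) (𝓝 0) := by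
    have : Continuous fun p : ℝ≥0 × X => ‖p.2 - x₀‖ + ‖E.op p.1 x₀ - E.op t₀ x₀‖ := by
      have := (E.continuous_orbit x₀).comp (continuous_fst (X := ℝ≥0) (Y := X))
      simp only [Function.comp_def] at this
      fun_prop
    simpa using this.tendsto (t₀, x₀)
  rw [ContinuousAt, tendsto_iff_norm_sub_tendsto_zero]
  refine squeeze_zero (fun _ => norm_nonneg _) (fun p => ?_) h1
  have : E.op p.1 p.2 - E.op t₀ x₀ = E.op p.1 (p.2 - x₀) + (E.op p.1 x₀ - E.op t₀ x₀) := by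
    simp
  rw [this]
  exact (norm_add_le _ _).trans (by gcongr; exact E.norm_op_apply_le hE _ _)

lemma C0Semigroup.op_zero_apply (x : X) : E.op 0 x = x := by simp [E.op_zero]

lemma C0Semigroup.op_toNNReal_add {a c : ℝ} (ha : 0 ≤ a) (hc : 0 ≤ c) (x : X) :
    E.op a.toNNReal (E.op c.toNNReal x) = E.op (a + c).toNNReal x := by
  rw [Real.toNNReal_add ha hc, E.op_add]; rfl

lemma C0Semigroup.aestronglyMeasurable_op (hE : ∀ t, ‖E.op t‖ ≤ 1) {μ : Measure ℝ}
    (hf : AEStronglyMeasurable f μ) (t : ℝ) :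
    AEStronglyMeasurable (fun r => E.op (t - r).toNNReal (f r)) μ := by
  have h1 : Continuous fun r : ℝ => (t - r).toNNReal := by fun_prop
  exact (E.continuous_op_uncurry hE).comp_aestronglyMeasurable
    (h1.aestronglyMeasurable.prodMk hf)

lemma C0Semigroup.intervalIntegrable_op (hE : ∀ t, ‖E.op t‖ ≤ 1) {a c : ℝ}
    (hf : IntervalIntegrable f volume a c) (t : ℝ) :
    IntervalIntegrable (fun r => E.op (t - r).toNNReal (f r)) volume a c := by
  refine hf.mono_fun (E.aestronglyMeasurable_op hE hf.aestronglyMeasurable_restrict_uIoc t) ?_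
  exact Eventually.of_forall fun r => E.norm_op_apply_le hE _ _

lemma C0Semigroup.norm_integral_op_le (hE : ∀ t, ‖E.op t‖ ≤ 1) {a c : ℝ} (hac : a ≤ c)
    (hf : ∀ᵐ r, r ∈ Ioc a c → ‖f r‖ ≤ M) (t : ℝ) :
    ‖∫ r in a..c, E.op (t - r).toNNReal (f r)‖ ≤ M * (c - a) := by
  rw [← abs_of_nonneg (sub_nonneg.2 hac)]
  apply intervalIntegral.norm_integral_le_of_norm_le_const_ae
  rw [uIoc_of_le hac]
  filter_upwards [hf] with r hr hr'
  exact (E.norm_op_apply_le hE _ _).trans (hr hr')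

lemma C0Semigroup.conv_self : E.conv f s s = 0 := by simp [C0Semigroup.conv]

lemma C0Semigroup.conv_congr_ae (hst : s ≤ t) (hff : ∀ᵐ r, r ∈ Ioc s t → f r = f' r) :
    E.conv f s t = E.conv f' s t := by
  apply intervalIntegral.integral_congr_ae
  rw [uIoc_of_le hst]
  filter_upwards [hff] with r hr hr'
  rw [hr hr']

lemma C0Semigroup.conv_comp_add_right (c : ℝ) :
    E.conv f (s + c) (t + c) = E.conv (fun r => f (r + c)) s t := by
  unfold C0Semigroup.conv
  rw [← intervalIntegral.integral_comp_add_right]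
  simp

lemma C0Semigroup.continuousOn_conv (hE : ∀ t, ‖E.op t‖ ≤ 1)
    (hf : IntervalIntegrable f volume s b) (hsb : s ≤ b) :
    ContinuousOn (fun t => E.conv f s t) (Icc s b) := by
  -- For `r > t` the integrand is `E(0) f(r) = f(r)`, so the convolution is an integral over a
  -- fixed interval minus a primitive of `f`.
  have key : ∀ t ∈ Icc s b,
      E.conv f s t = (∫ r in s..b, E.op (t - r).toNNReal (f r)) - ∫ r in t..b, f r := by
    intro t ht
    have hc : t ∈ uIcc s b := by rw [uIcc_of_le hsb]; exact ht
    have h1 : IntervalIntegrable f volume s t := hf.mono_set (uIcc_subset_uIcc_left hc)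
    have h2 : IntervalIntegrable f volume t b := hf.mono_set (uIcc_subset_uIcc_right hc)
    rw [← intervalIntegral.integral_add_adjacent_intervals (E.intervalIntegrable_op hE h1 t)
      (E.intervalIntegrable_op hE h2 t), C0Semigroup.conv, eq_comm, add_sub_assoc,
      add_eq_left, sub_eq_zero]
    apply intervalIntegral.integral_congr
    intro r hr
    rw [uIcc_of_le ht.2] at hr
    simp only
    rw [Real.toNNReal_of_nonpos (by linarith [hr.1]), E.op_zero_apply]
  refine ContinuousOn.congr ?_ key
  refine ContinuousOn.sub (Continuous.continuousOn ?_) ?_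
  · refine intervalIntegral.continuous_of_dominated_interval (bound := fun r => ‖f r‖)
      (fun t => E.aestronglyMeasurable_op hE hf.aestronglyMeasurable_restrict_uIoc t)
      (fun t => Eventually.of_forall fun r _ => E.norm_op_apply_le hE _ _) hf.norm
      (Eventually.of_forall fun r _ => ?_)
    exact (E.continuous_orbit (f r)).comp (by fun_prop)
  · have h := intervalIntegral.continuousOn_primitive_interval_left
      (f := f) (a := s) (b := b) (μ := volume) ?_
    · rwa [uIcc_of_le hsb] at h
    · rw [uIcc_of_le hsb]
      exact (intervalIntegrable_iff_integrableOn_Icc_of_le hsb).1 hf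

variable [CompleteSpace X]

/-- Restarting the convolution at an intermediate time. -/
lemma C0Semigroup.conv_eq_add (hE : ∀ t, ‖E.op t‖ ≤ 1) {c : ℝ}
    (hf : IntervalIntegrable f volume s t) (hsc : s ≤ c) (hct : c ≤ t) :
    E.conv f s t = E.op (t - c).toNNReal (E.conv f s c) + E.conv f c t := by
  have hc : c ∈ uIcc s t := by rw [uIcc_of_le (hsc.trans hct)]; exact ⟨hsc, hct⟩
  have h1 : IntervalIntegrable f volume s c := hf.mono_set (uIcc_subset_uIcc_left hc)
  have h2 : IntervalIntegrable f volume c t := hf.mono_set (uIcc_subset_uIcc_right hc)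
  unfold C0Semigroup.conv
  rw [← intervalIntegral.integral_add_adjacent_intervals (E.intervalIntegrable_op hE h1 t)
    (E.intervalIntegrable_op hE h2 t),
    ← ContinuousLinearMap.intervalIntegral_comp_comm _ (E.intervalIntegrable_op hE h1 c)]
  congr 1
  apply intervalIntegral.integral_congr
  intro r hr
  rw [uIcc_of_le hsc] at hr
  simp only
  rw [E.op_toNNReal_add (sub_nonneg.2 hct) (sub_nonneg.2 hr.2)]
  ring_nf

end Convolution

/-- Gronwall's inequality in integral form. -/
lemma le_mul_exp_of_le_add_integral {f : ℝ → ℝ} {a b c L : ℝ} (hL : 0 ≤ L)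
    (hf : ContinuousOn f (Icc a b))
    (hle : ∀ t ∈ Icc a b, f t ≤ c + L * ∫ r in a..t, f r) :
    ∀ t ∈ Icc a b, f t ≤ c * Real.exp (L * (t - a)) := by
  intro t ht
  have hab : a ≤ b := ht.1.trans ht.2
  -- Extend `f` continuously, so that its primitive is differentiable everywhere.
  set F := IccExtend hab ((Icc a b).domRestrict f) with hF
  have hFc : Continuous F := (continuousOn_iff_continuous_domRestrict.1 hf).Icc_extend'
  have hFf : ∀ r ∈ Icc a b, F r = f r := fun r hr => IccExtend_of_mem hab _ hr
  have hint : ∀ t ∈ Icc a b, ∫ r in a..t, f r = ∫ r in a..t, F r := by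
    intro t ht
    apply intervalIntegral.integral_congr
    intro r hr
    rw [uIcc_of_le ht.1] at hr
    exact (hFf r ⟨hr.1, hr.2.trans ht.2⟩).symm
  have hd : ∀ x, HasDerivAt (fun t => c + L * ∫ r in a..t, F r) (L * F x) x := fun x =>
    ((intervalIntegral.integral_hasDerivAt_right (hFc.intervalIntegrable _ _)
      (hFc.stronglyMeasurableAtFilter _ _) hFc.continuousAt).const_mul L).const_add c
  have := le_gronwallBound_of_liminf_deriv_right_le (f := fun t => c + L * ∫ r in a..t, F r)
    (f' := fun x => L * F x) (δ := c) (K := L) (ε := 0) (a := a) (b := b)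
    (fun x _ => (hd x).continuousAt.continuousWithinAt)
    (fun x _ r hr => ((hd x).hasDerivWithinAt (s := Ici x)).liminf_right_slope_le hr)
    (by simp) (fun x hx => ?_) t ht
  · rw [gronwallBound_ε0] at this
    refine (hle t ht).trans ?_
    rwa [hint t ht]
  · have hx' : x ∈ Icc a b := ⟨hx.1, hx.2.le⟩
    rw [add_zero, hFf x hx', ← hint x hx']
    exact mul_le_mul_of_nonneg_left (hle x hx') hL

/-! ### Solutions on compact intervals -/

section Solutions

variable {X : Type*} [NormedAddCommGroup X]

/-- A forcing term on `[0, ∞)`: measurable and almost everywhere bounded by `M`. -/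
structure IsForcing (w : ℝ → X) (M : ℝ) : Prop where
  aestronglyMeasurable : AEStronglyMeasurable w halfLine
  norm_le : ∀ᵐ r ∂halfLine, ‖w r‖ ≤ M

variable {w w' : ℝ → X} {s b c t M m : ℝ} {G : X → X} {x y : ℝ → X}

lemma ae_mem_Ioc_of_ae_halfLine {p : ℝ → Prop} (hp : ∀ᵐ r ∂halfLine, p r) (hs : 0 ≤ s) :
    ∀ᵐ r, r ∈ Ioc s b → p r := by
  filter_upwards [(ae_restrict_iff' measurableSet_Ici).1 hp] with r hr hr'
  exact hr (hs.trans hr'.1.le)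

lemma IsForcing.ae_Ioc (hw : IsForcing w M) (hs : 0 ≤ s) :
    ∀ᵐ r, r ∈ Ioc s b → ‖w r‖ ≤ M := ae_mem_Ioc_of_ae_halfLine hw.norm_le hs

lemma IsForcing.intervalIntegrable (hw : IsForcing w M) (hs : 0 ≤ s) (hsb : s ≤ b) :
    IntervalIntegrable w volume s b := by
  rw [intervalIntegrable_iff, uIoc_of_le hsb]
  refine Integrable.of_bound ?_ M ?_
  · exact hw.aestronglyMeasurable.mono_measure
      (Measure.restrict_mono_set _ fun r (hr : r ∈ Ioc s b) => hs.trans hr.1.le)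
  · exact (ae_restrict_iff' measurableSet_Ioc).2 (hw.ae_Ioc hs)

lemma IsForcing.nonneg (hw : IsForcing w M) : 0 ≤ M := by
  have : (ae halfLine).NeBot := by
    rw [ae_neBot, Ne, Measure.restrict_eq_zero]
    simp
  obtain ⟨r, hr⟩ := hw.norm_le.exists
  exact (norm_nonneg _).trans hr

lemma IsForcing.mono {M' : ℝ} (hw : IsForcing w M) (hM : M ≤ M') : IsForcing w M' :=
  ⟨hw.1, hw.2.mono fun _ h => h.trans hM⟩

lemma IsForcing.zero : IsForcing (fun _ => (0 : X)) 0 :=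
  ⟨aestronglyMeasurable_const, by simp⟩

lemma LipschitzOnBounded.continuous {g : X → X} (hg : LipschitzOnBounded g) : Continuous g := by
  rw [continuous_iff_continuousAt]
  intro x
  obtain ⟨L, hL⟩ := hg _ (Metric.isBounded_ball (x := x) (r := 1))
  exact hL.continuousOn.continuousAt (Metric.ball_mem_nhds x one_pos)

variable [NormedSpace ℝ X] {E : C0Semigroup X}

/-- `x` is a mild solution of `x' = A x + G(x) + w` on the compact interval `[s, b]`, where `A`
generates `E`; the initial value is `x s`. -/
structure IsSol (E : C0Semigroup X) (G : X → X) (w : ℝ → X) (s b : ℝ) (x : ℝ → X) : Prop where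
  continuousOn : ContinuousOn x (Icc s b)
  eq : ∀ t ∈ Icc s b,
    x t = E.op (t - s).toNNReal (x s) + E.conv (fun r => G (x r) + w r) s t

lemma IsSol.intervalIntegrable_comp (hx : IsSol E G w s b x) (hG : Continuous G)
    (hsb : s ≤ b) : IntervalIntegrable (fun r => G (x r)) volume s b := by
  apply ContinuousOn.intervalIntegrable
  rw [uIcc_of_le hsb]
  exact hG.comp_continuousOn hx.continuousOn

lemma IsSol.intervalIntegrable (hx : IsSol E G w s b x) (hG : Continuous G)
    (hw : IsForcing w M) (hs : 0 ≤ s) (hsb : s ≤ b) :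
    IntervalIntegrable (fun r => G (x r) + w r) volume s b :=
  (hx.intervalIntegrable_comp hG hsb).add (hw.intervalIntegrable hs hsb)

lemma IsSol.mono (hx : IsSol E G w s b x) (hcb : c ≤ b) : IsSol E G w s c x :=
  ⟨hx.continuousOn.mono (Icc_subset_Icc_right hcb), fun t ht => hx.eq t ⟨ht.1, ht.2.trans hcb⟩⟩

/-- The nonlinearity only matters on the range of the solution, the forcing term only up to null
sets. -/
lemma IsSol.congr_data {G' : X → X} (hx : IsSol E G w s b x)
    (hG : ∀ t ∈ Icc s b, G' (x t) = G (x t)) (hw : ∀ᵐ r, r ∈ Ioc s b → w' r = w r) :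
    IsSol E G' w' s b x := by
  refine ⟨hx.continuousOn, fun t ht => ?_⟩
  rw [hx.eq t ht]
  congr 1
  refine E.conv_congr_ae ht.1 ?_
  filter_upwards [hw] with r hr hr'
  rw [hr ⟨hr'.1, hr'.2.trans ht.2⟩, hG r ⟨hr'.1.le, hr'.2.trans ht.2⟩]

lemma IsSol.comp_add_right (hx : IsSol E G w (s + c) (b + c) x) :
    IsSol E G (fun r => w (r + c)) s b (fun t => x (t + c)) := by
  refine ⟨hx.continuousOn.comp (by fun_prop) fun t ht => ?_, fun t ht => ?_⟩
  · simpa using ht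
  · rw [hx.eq (t + c) (by simpa using ht), E.conv_comp_add_right]
    simp

/-- The variation of constants formula restarted at an intermediate time. -/
lemma IsSol.eq_restart [CompleteSpace X] (hE : ∀ t, ‖E.op t‖ ≤ 1) (hx : IsSol E G w s b x)
    (hG : Continuous G) (hw : IsForcing w M) (hs : 0 ≤ s) (hsc : s ≤ c) (hct : c ≤ t)
    (htb : t ≤ b) :
    x t = E.op (t - c).toNNReal (x c) + E.conv (fun r => G (x r) + w r) c t := by
  have hint := ((hx.mono htb).intervalIntegrable hG hw hs (hsc.trans hct))
  rw [hx.eq t ⟨hsc.trans hct, htb⟩, hx.eq c ⟨hsc, hct.trans htb⟩,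
    E.conv_eq_add hE hint hsc hct, map_add,
    E.op_toNNReal_add (sub_nonneg.2 hct) (sub_nonneg.2 hsc), ← add_assoc,
    sub_add_sub_cancel]

lemma IsSol.restart [CompleteSpace X] (hE : ∀ t, ‖E.op t‖ ≤ 1) (hx : IsSol E G w s b x)
    (hG : Continuous G) (hw : IsForcing w M) (hs : 0 ≤ s) (hsc : s ≤ c) :
    IsSol E G w c b x :=
  ⟨hx.continuousOn.mono (Icc_subset_Icc_left hsc),
    fun _ ht => hx.eq_restart hE hG hw hs hsc ht.1 ht.2⟩

/-- Continuous dependence on the initial value and on the forcing term. -/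
lemma IsSol.norm_sub_le (hE : ∀ t, ‖E.op t‖ ≤ 1) {D : Set X} {L : ℝ≥0} {M' : ℝ}
    (hG : Continuous G) (hGL : LipschitzOnWith L G D)
    (hx : IsSol E G w s b x) (hy : IsSol E G w' s b y)
    (hw : IsForcing w M) (hw' : IsForcing w' M') (hs : 0 ≤ s)
    (hxD : ∀ t ∈ Icc s b, x t ∈ D) (hyD : ∀ t ∈ Icc s b, y t ∈ D)
    (hm : 0 ≤ m) (hww : ∀ᵐ r, r ∈ Ioc s b → ‖w r - w' r‖ ≤ m) :
    ∀ t ∈ Icc s b, ‖x t - y t‖ ≤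
      (‖x s - y s‖ + m * (b - s)) * Real.exp (L * (t - s)) := by
  intro t₀ ht₀
  have hsb : s ≤ b := ht₀.1.trans ht₀.2
  refine le_mul_exp_of_le_add_integral (f := fun t => ‖x t - y t‖) L.coe_nonneg
    (hx.continuousOn.sub hy.continuousOn).norm (fun t ht => ?_) t₀ ht₀
  have hxt := hx.mono ht.2
  have hyt := hy.mono ht.2
  have hix := E.intervalIntegrable_op hE (hxt.intervalIntegrable hG hw hs ht.1) t
  have hiy := E.intervalIntegrable_op hE (hyt.intervalIntegrable hG hw' hs ht.1) t
  have hiG := E.intervalIntegrable_op hE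
    ((hxt.intervalIntegrable_comp hG ht.1).sub (hyt.intervalIntegrable_comp hG ht.1)) t
  have hiw := E.intervalIntegrable_op hE
    ((hw.intervalIntegrable hs ht.1).sub (hw'.intervalIntegrable hs ht.1)) t
  have hdec : x t - y t = E.op (t - s).toNNReal (x s - y s)
      + ((∫ r in s..t, E.op (t - r).toNNReal (G (x r) - G (y r)))
        + ∫ r in s..t, E.op (t - r).toNNReal (w r - w' r)) := by
    rw [hx.eq t ht, hy.eq t ht, ← intervalIntegral.integral_add hiG hiw, map_sub,
      add_sub_add_comm]
    congr 1
    rw [C0Semigroup.conv, C0Semigroup.conv, ← intervalIntegral.integral_sub hix hiy]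
    congr 1
    ext r
    simp only [map_add, map_sub]
    abel
  have h1 : ‖∫ r in s..t, E.op (t - r).toNNReal (G (x r) - G (y r))‖
      ≤ L * ∫ r in s..t, ‖x r - y r‖ := by
    rw [← intervalIntegral.integral_const_mul]
    refine intervalIntegral.norm_integral_le_of_norm_le ht.1
      (Eventually.of_forall fun r hr => ?_) ?_
    · have hr' : r ∈ Icc s b := ⟨hr.1.le, hr.2.trans ht.2⟩
      refine (E.norm_op_apply_le hE _ _).trans ?_
      simpa only [dist_eq_norm] using hGL.dist_le_mul _ (hxD r hr') _ (hyD r hr')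
    · apply ContinuousOn.intervalIntegrable
      rw [uIcc_of_le ht.1]
      exact continuousOn_const.mul (hxt.continuousOn.sub hyt.continuousOn).norm
  have h2 : ‖∫ r in s..t, E.op (t - r).toNNReal (w r - w' r)‖ ≤ m * (b - s) := by
    refine (E.norm_integral_op_le hE ht.1 (M := m) ?_ t).trans (by gcongr; exact ht.2)
    filter_upwards [hww] with r hr hr'
    exact hr ⟨hr'.1, hr'.2.trans ht.2⟩
  have h3 := E.norm_op_apply_le hE (t - s).toNNReal (x s - y s)
  rw [hdec]
  refine (norm_add_le _ _).trans ?_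
  have := norm_add_le (∫ r in s..t, E.op (t - r).toNNReal (G (x r) - G (y r)))
    (∫ r in s..t, E.op (t - r).toNNReal (w r - w' r))
  linarith

/-- Solutions are uniquely determined by their initial value. -/
lemma IsSol.eqOn (hE : ∀ t, ‖E.op t‖ ≤ 1) (hG : LipschitzOnBounded G)
    (hx : IsSol E G w s b x) (hy : IsSol E G w s b y) (hw : IsForcing w M) (hs : 0 ≤ s)
    (hxy : x s = y s) : EqOn x y (Icc s b) := by
  intro t ht
  have hB : Bornology.IsBounded (x '' Icc s b ∪ y '' Icc s b) :=
    (isCompact_Icc.image_of_continuousOn hx.continuousOn).isBounded.union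
      (isCompact_Icc.image_of_continuousOn hy.continuousOn).isBounded
  obtain ⟨L, hL⟩ := hG _ hB
  have := hx.norm_sub_le hE hG.continuous hL hy hw hw hs
    (fun t ht => Or.inl (mem_image_of_mem _ ht)) (fun t ht => Or.inr (mem_image_of_mem _ ht))
    le_rfl (by simp) t ht
  rw [hxy] at this
  simpa [sub_eq_zero] using this

end Solutions

/-! ### The energy estimate -/

section Energy

variable {X : Type*} [NormedAddCommGroup X] [InnerProductSpace ℝ X] [CompleteSpace X]
  {E : C0Semigroup X} {G : X → X} {w x : ℝ → X} {s b t M ω ω' C : ℝ}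

/-- As `z ↓ t`, the averaged convolution with a continuous function tends to its value at `t`. -/
lemma C0Semigroup.tendsto_inv_smul_conv (hE : ∀ t, ‖E.op t‖ ≤ 1) {f : ℝ → X}
    (hf : ContinuousOn f (Icc s b)) (ht : t ∈ Ico s b) :
    Tendsto (fun z => (z - t)⁻¹ • E.conv f t z) (𝓝[>] t) (𝓝 (f t)) := by
  rw [Metric.tendsto_nhds]
  intro ε hε
  have h1 : ∀ᶠ r in 𝓝[≥] t, ‖f r - f t‖ < ε / 3 := by
    have : Tendsto f (𝓝[≥] t) (𝓝 (f t)) :=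
      ((hf t ⟨ht.1, ht.2.le⟩).mono_of_mem_nhdsWithin
        (mem_of_superset (Icc_mem_nhdsGE ht.2) (Icc_subset_Icc_left ht.1)))
    simpa [dist_eq_norm] using Metric.tendsto_nhds.1 this (ε / 3) (by positivity)
  have h2 : ∀ᶠ d in 𝓝 (0 : ℝ), ‖E.op d.toNNReal (f t) - f t‖ < ε / 3 := by
    have : Continuous fun d : ℝ => E.op d.toNNReal (f t) :=
      (E.continuous_orbit (f t)).comp (by fun_prop)
    have := this.tendsto 0
    simp only [Real.toNNReal_zero, E.op_zero_apply] at this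
    simpa [dist_eq_norm] using Metric.tendsto_nhds.1 this (ε / 3) (by positivity)
  obtain ⟨u, hu, hu1⟩ := mem_nhdsGE_iff_exists_Ico_subset.1 h1
  obtain ⟨η, hη, hη2⟩ := Metric.eventually_nhds_iff.1 h2
  have h3 : ∀ᶠ z in 𝓝[>] t, z ∈ Ioo t (min (min u b) (t + η)) :=
    Ioo_mem_nhdsGT (by simp [mem_Ioi.1 hu, ht.2, hη])
  filter_upwards [h3] with z hz
  have hz1 : 0 < z - t := sub_pos.2 hz.1
  have hz2 := hz.2
  simp only [lt_min_iff] at hz2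
  have hfi : IntervalIntegrable f volume t z := by
    apply ContinuousOn.intervalIntegrable
    rw [uIcc_of_le hz.1.le]
    exact hf.mono (Icc_subset_Icc ht.1 hz2.1.2.le)
  have hbound : ‖E.conv f t z - (z - t) • f t‖ ≤ (2 * ε / 3) * (z - t) := by
    have : (z - t) • f t = ∫ _ in t..z, f t := by simp
    rw [this, C0Semigroup.conv, ← intervalIntegral.integral_sub
      (E.intervalIntegrable_op hE hfi z) intervalIntegrable_const, ← abs_of_pos hz1]
    apply intervalIntegral.norm_integral_le_of_norm_le_const
    intro r hr
    rw [uIoc_of_le hz.1.le] at hr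
    have e : E.op (z - r).toNNReal (f r) - f t = E.op (z - r).toNNReal (f r - f t)
        + (E.op (z - r).toNNReal (f t) - f t) := by simp
    rw [e]
    have i1 := E.norm_op_apply_le hE (z - r).toNNReal (f r - f t)
    have i2 : ‖f r - f t‖ < ε / 3 := hu1 ⟨hr.1.le, by linarith [hr.2]⟩
    have i3 : ‖E.op (z - r).toNNReal (f t) - f t‖ < ε / 3 := by
      apply hη2
      rw [Real.dist_0_eq_abs, abs_of_nonneg (by linarith [hr.2])]
      linarith [hr.1]
    have := norm_add_le (E.op (z - r).toNNReal (f r - f t)) (E.op (z - r).toNNReal (f t) - f t)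
    linarith
  have e2 : (z - t)⁻¹ • E.conv f t z - f t
      = (z - t)⁻¹ • (E.conv f t z - (z - t) • f t) := by
    rw [smul_sub, smul_smul, inv_mul_cancel₀ hz1.ne', one_smul]
  rw [dist_eq_norm, e2, norm_smul, norm_inv, Real.norm_of_nonneg hz1.le]
  calc (z - t)⁻¹ * ‖E.conv f t z - (z - t) • f t‖
      ≤ (z - t)⁻¹ * ((2 * ε / 3) * (z - t)) := by gcongr
    _ = 2 * ε / 3 := by field_simp
    _ < ε := by linarith

/-- The energy inequality for the upper right Dini derivative of `‖x‖²`. It replaces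
`(‖x‖²)' = 2⟨x, A x + G(x) + w⟩`, which is meaningless for mild solutions. -/
lemma IsSol.eventually_slope_norm_sq_lt (hE : ∀ t, ‖E.op t‖ ≤ 1)
    (hdecay : ∀ t : ℝ≥0, ‖E.op t‖ ≤ Real.exp (-ω * t))
    (hG : Continuous G) (hx : IsSol E G w s b x) (hw : IsForcing w M) (hs : 0 ≤ s)
    (ht : t ∈ Ico s b) {c : ℝ}
    (hc : -2 * ω * ‖x t‖ ^ 2 + 2 * inner ℝ (x t) (G (x t)) + 2 * (M * ‖x t‖) < c) :
    ∀ᶠ z in 𝓝[>] t, slope (fun r => ‖x r‖ ^ 2) t z < c := by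
  have hGx : ContinuousOn (fun r => G (x r)) (Icc s b) := hG.comp_continuousOn hx.continuousOn
  set q : ℝ → X := fun z => (z - t)⁻¹ • E.conv (fun r => G (x r)) t z with hq
  have hqt : Tendsto q (𝓝[>] t) (𝓝 (G (x t))) := E.tendsto_inv_smul_conv hE hGx ht
  have hexp : Tendsto (fun z => (z - t)⁻¹ * (Real.exp (-2 * ω * (z - t)) - 1)) (𝓝[>] t)
      (𝓝 (-2 * ω)) := by
    have h1 : HasDerivAt (fun z => Real.exp (-2 * ω * (z - t))) (-2 * ω) t := by
      have := ((((hasDerivAt_id t).sub_const t).const_mul (-2 * ω)).exp)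
      simpa using this
    have h2 := (hasDerivAt_iff_tendsto_slope.1 h1).mono_left
      (nhdsWithin_mono t fun z (hz : t < z) => hz.ne')
    refine (h2.congr fun z => ?_)
    simp [slope]
  have hop : Tendsto (fun z => E.op (z - t).toNNReal (x t)) (𝓝[>] t) (𝓝 (x t)) := by
    have : Continuous fun z : ℝ => E.op (z - t).toNNReal (x t) :=
      (E.continuous_orbit (x t)).comp (by fun_prop)
    have := this.tendsto t
    simp only [sub_self, Real.toNNReal_zero, E.op_zero_apply] at this
    exact this.mono_left nhdsWithin_le_nhds
  have hz0 : Tendsto (fun z => z - t) (𝓝[>] t) (𝓝 0) := by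
    have : Continuous fun z : ℝ => z - t := by fun_prop
    have := this.tendsto t
    rw [sub_self] at this
    exact this.mono_left nhdsWithin_le_nhds
  have hlim : Tendsto (fun z => (z - t)⁻¹ * (Real.exp (-2 * ω * (z - t)) - 1) * ‖x t‖ ^ 2
      + 2 * inner ℝ (E.op (z - t).toNNReal (x t)) (q z) + 2 * (M * ‖x t‖)
      + (z - t) * (‖q z‖ + M) ^ 2) (𝓝[>] t)
      (𝓝 (-2 * ω * ‖x t‖ ^ 2 + 2 * inner ℝ (x t) (G (x t)) + 2 * (M * ‖x t‖)
        + 0 * (‖G (x t)‖ + M) ^ 2)) :=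
    ((((hexp.mul_const _).add ((hop.inner hqt).const_mul 2)).add_const _).add
      (hz0.mul ((hqt.norm.add_const M).pow 2)))
  rw [zero_mul, add_zero] at hlim
  have hzb : ∀ᶠ z in 𝓝[>] t, z ∈ Ioo t b := Ioo_mem_nhdsGT ht.2
  filter_upwards [hlim.eventually (gt_mem_nhds hc), hzb] with z hzc hz
  refine lt_of_le_of_lt ?_ hzc
  have hd : 0 < z - t := sub_pos.2 hz.1
  have htz := hz.1.le
  have hs' : 0 ≤ t := hs.trans ht.1
  have hxt := (hx.restart hE hG hw hs ht.1).mono hz.2.le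
  set e := E.op (z - t).toNNReal (x t) with he
  set J := ∫ r in t..z, E.op (z - r).toNNReal (w r) with hJ
  have hxz : x z = e + ((z - t) • q z + J) := by
    rw [hxt.eq z ⟨htz, le_rfl⟩, hq]
    simp only
    rw [smul_smul, mul_inv_cancel₀ hd.ne', one_smul, he, hJ, C0Semigroup.conv, C0Semigroup.conv,
      ← intervalIntegral.integral_add
        (E.intervalIntegrable_op hE (hxt.intervalIntegrable_comp hG htz) z)
        (E.intervalIntegrable_op hE (hw.intervalIntegrable hs' htz) z)]
    simp only [map_add]
  have hJn : ‖J‖ ≤ M * (z - t) := E.norm_integral_op_le hE htz (hw.ae_Ioc hs') z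
  have he1 : ‖e‖ ≤ ‖x t‖ := E.norm_op_apply_le hE _ _
  have he2 : ‖e‖ ^ 2 ≤ Real.exp (-2 * ω * (z - t)) * ‖x t‖ ^ 2 := by
    have h := (E.op (z - t).toNNReal).le_of_opNorm_le (hdecay _) (x t)
    rw [Real.coe_toNNReal _ hd.le] at h
    calc ‖e‖ ^ 2 ≤ (Real.exp (-ω * (z - t)) * ‖x t‖) ^ 2 := by gcongr
      _ = _ := by rw [mul_pow, ← Real.exp_nat_mul]; push_cast; ring_nf
  have hin : inner ℝ e J ≤ ‖x t‖ * (M * (z - t)) :=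
    (real_inner_le_norm _ _).trans (by gcongr)
  have hqJ : ‖(z - t) • q z + J‖ ≤ (z - t) * (‖q z‖ + M) := by
    refine (norm_add_le _ _).trans ?_
    rw [norm_smul, Real.norm_of_nonneg hd.le]
    linarith
  have hqJ2 : ‖(z - t) • q z + J‖ ^ 2 ≤ ((z - t) * (‖q z‖ + M)) ^ 2 := by gcongr
  have hmain : ‖x z‖ ^ 2 - ‖x t‖ ^ 2 ≤ (Real.exp (-2 * ω * (z - t)) - 1) * ‖x t‖ ^ 2
      + 2 * ((z - t) * inner ℝ e (q z)) + 2 * (‖x t‖ * (M * (z - t)))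
      + ((z - t) * (‖q z‖ + M)) ^ 2 := by
    rw [hxz, norm_add_sq_real, inner_add_right, inner_smul_right]
    linarith
  rw [slope_def_field, div_le_iff₀ hd]
  refine hmain.trans (le_of_eq ?_)
  field_simp

/-- The asymptotic bound for `‖x‖²` along trajectories, for dissipativity constants `a = ω - ω'`, `C`
and forcing terms bounded by `M`: the equilibrium of `φ' = -a φ + 2 C + M² / a`. -/
noncomputable def absorbSq (a C M : ℝ) : ℝ := (2 * C + M ^ 2 / a) / a

lemma absorbSq_nonneg {a C : ℝ} (ha : 0 < a) (hC : 0 ≤ C) (M : ℝ) : 0 ≤ absorbSq a C M := by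
  unfold absorbSq; positivity

/-- The energy estimate. Dissipativity is only required on a ball that the trajectory does not
leave, so that the estimate also applies to truncations of the nonlinearity. -/
lemma IsSol.norm_sq_le (hE : ∀ t, ‖E.op t‖ ≤ 1)
    (hdecay : ∀ t : ℝ≥0, ‖E.op t‖ ≤ Real.exp (-ω * t)) (hω : ω' < ω) (hC : 0 ≤ C)
    (hG : Continuous G) (hx : IsSol E G w s b x) (hw : IsForcing w M) (hs : 0 ≤ s)
    (hdamp : ∀ y, ‖y‖ ^ 2 ≤ ‖x s‖ ^ 2 + absorbSq (ω - ω') C M + 1 →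
      inner ℝ y (G y) ≤ C + ω' * ‖y‖ ^ 2) :
    ∀ t ∈ Icc s b,
      ‖x t‖ ^ 2 ≤ Real.exp (-(ω - ω') * (t - s)) * ‖x s‖ ^ 2 + absorbSq (ω - ω') C M := by
  set a := ω - ω' with ha_def
  have ha : 0 < a := sub_pos.2 hω
  set K := absorbSq a C M with hK
  have haK : a * K = 2 * C + M ^ 2 / a := by rw [hK, absorbSq]; field_simp
  have key : ∀ ε : ℝ, 0 < ε → ε ≤ 1 → ∀ t ∈ Icc s b,
      ‖x t‖ ^ 2 ≤ Real.exp (-a * (t - s)) * ‖x s‖ ^ 2 + K + ε := by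
    intro ε hε hε1 t ht
    refine image_le_of_liminf_slope_right_lt_deriv_boundary (a := s) (b := b)
      (f := fun r => ‖x r‖ ^ 2)
      (f' := fun r => -2 * ω * ‖x r‖ ^ 2 + 2 * inner ℝ (x r) (G (x r)) + 2 * (M * ‖x r‖))
      (B := fun r => Real.exp (-a * (r - s)) * ‖x s‖ ^ 2 + K + ε)
      (B' := fun r => -a * (Real.exp (-a * (r - s)) * ‖x s‖ ^ 2))
      (hx.continuousOn.norm.pow 2) ?_ ?_ ?_ ?_ ht
    · intro r hr c hc
      exact (hx.eventually_slope_norm_sq_lt hE hdecay hG hw hs hr hc).frequently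
    · have := absorbSq_nonneg ha hC M
      simp only [sub_self, mul_zero, Real.exp_zero, one_mul]
      linarith
    · intro r
      have := ((((((hasDerivAt_id r).sub_const s).const_mul (-a)).exp).mul_const
        (‖x s‖ ^ 2)).add_const K).add_const ε
      refine this.congr_deriv ?_
      simp only [id]
      ring
    · intro r hr hrB
      have hle1 : Real.exp (-a * (r - s)) * ‖x s‖ ^ 2 ≤ 1 * ‖x s‖ ^ 2 := by
        gcongr
        rw [Real.exp_le_one_iff]
        nlinarith [hr.1]
      have h1 := hdamp (x r) (by linarith)
      -- Young's inequality `2 M ‖x‖ ≤ a ‖x‖² + M² / a`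
      have h2 : 2 * (M * ‖x r‖) ≤ a * ‖x r‖ ^ 2 + M ^ 2 / a := by
        have h3 : 0 ≤ (a * ‖x r‖ - M) ^ 2 / a := by positivity
        have h4 : (a * ‖x r‖ - M) ^ 2 / a = a * ‖x r‖ ^ 2 - 2 * (M * ‖x r‖) + M ^ 2 / a := by
          field_simp; ring
        linarith
      have h5 : Real.exp (-a * (r - s)) * ‖x s‖ ^ 2 = ‖x r‖ ^ 2 - K - ε := by linarith
      rw [h5]
      have h6 : 0 < a * ε := by positivity
      have h7 : ω = a + ω' := by rw [ha_def]; ring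
      rw [h7]
      nlinarith
  intro t ht
  refine le_of_forall_pos_le_add fun ε hε => ?_
  refine (key (min ε 1) (by positivity) (min_le_right _ _) t ht).trans ?_
  gcongr
  exact min_le_left _ _

end Energy

/-! ### Global existence -/

section Cutoff

variable {X : Type*} [NormedAddCommGroup X]

/-- A continuous cut-off function, equal to `1` on the ball of radius `R` and to `0` outside the
ball of radius `R + 1`. -/
noncomputable def cutoff (R : ℝ) (x : X) : ℝ := max 0 (min 1 (R + 1 - ‖x‖))

lemma cutoff_nonneg (R : ℝ) (x : X) : 0 ≤ cutoff R x := le_max_left _ _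

lemma cutoff_le_one (R : ℝ) (x : X) : cutoff R x ≤ 1 := max_le zero_le_one (min_le_left _ _)

lemma cutoff_of_le {R : ℝ} {x : X} (hx : ‖x‖ ≤ R) : cutoff R x = 1 := by
  unfold cutoff
  rw [min_eq_left (by linarith), max_eq_right zero_le_one]

lemma cutoff_of_ge {R : ℝ} {x : X} (hx : R + 1 ≤ ‖x‖) : cutoff R x = 0 := by
  unfold cutoff
  rw [max_eq_left]
  exact (min_le_right _ _).trans (by linarith)

lemma abs_cutoff_sub_le (R : ℝ) (x y : X) : |cutoff R x - cutoff R y| ≤ ‖x - y‖ := by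
  unfold cutoff
  refine (abs_max_sub_max_le_max _ _ _ _).trans ?_
  rw [sub_self, abs_zero, max_eq_right (abs_nonneg _)]
  refine (abs_min_sub_min_le_max _ _ _ _).trans ?_
  rw [sub_self, abs_zero, max_eq_right (abs_nonneg _), sub_sub_sub_cancel_left, norm_sub_rev x y]
  exact abs_norm_sub_norm_le y x

variable [NormedSpace ℝ X]

/-- A map that is Lipschitz on bounded sets agrees, on a given ball, with a map that is globally
Lipschitz and bounded. -/
lemma LipschitzOnBounded.exists_truncation {g : X → X} (hg : LipschitzOnBounded g) (R : ℝ) :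
    ∃ (G : X → X) (L : ℝ≥0) (N : ℝ), LipschitzWith L G ∧ (∀ x, ‖G x‖ ≤ N) ∧
      ∀ x, ‖x‖ ≤ R → G x = g x := by
  obtain ⟨L, hL⟩ := hg _ (Metric.isBounded_closedBall (x := (0 : X)) (r := |R| + 1))
  have h0 : (0 : X) ∈ Metric.closedBall (0 : X) (|R| + 1) := by
    simp; positivity
  set N : ℝ := ‖g 0‖ + L * (|R| + 1) with hN
  have hN0 : 0 ≤ N := by positivity
  have hbd : ∀ x, ‖x‖ ≤ |R| + 1 → ‖g x‖ ≤ N := by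
    intro x hx
    have h1 := hL.dist_le_mul x (by simpa using hx) 0 h0
    rw [dist_eq_norm, dist_zero_right] at h1
    have h2 := norm_le_insert' (g x) (g 0)
    have h3 : (L : ℝ) * ‖x‖ ≤ L * (|R| + 1) := by gcongr
    linarith
  set G : X → X := fun x => cutoff |R| x • g x with hG
  -- The estimate when the second point lies in the larger ball; the factor `g y` is bounded there.
  have hone : ∀ x y, ‖y‖ ≤ |R| + 1 → ‖G x - G y‖ ≤ (L + N) * ‖x - y‖ := by
    intro x y hy
    have e : G x - G y = cutoff |R| x • (g x - g y) + (cutoff |R| x - cutoff |R| y) • g y := by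
      simp only [hG]; module
    have h2 : ‖(cutoff |R| x - cutoff |R| y) • g y‖ ≤ N * ‖x - y‖ := by
      rw [norm_smul, Real.norm_eq_abs, mul_comm]
      gcongr
      · exact hbd y hy
      · exact abs_cutoff_sub_le _ _ _
    have h1 : ‖cutoff |R| x • (g x - g y)‖ ≤ L * ‖x - y‖ := by
      rcases le_total ‖x‖ (|R| + 1) with hx | hx
      · rw [norm_smul, Real.norm_of_nonneg (cutoff_nonneg _ _)]
        have := hL.dist_le_mul x (by simpa using hx) y (by simpa using hy)
        rw [dist_eq_norm, dist_eq_norm] at this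
        exact (mul_le_of_le_one_left (norm_nonneg _) (cutoff_le_one _ _)).trans this
      · rw [cutoff_of_ge hx, zero_smul, norm_zero]; positivity
    rw [e]
    refine (norm_add_le _ _).trans ?_
    linarith
  refine ⟨G, L + N.toNNReal, N, LipschitzWith.of_dist_le_mul fun x y => ?_, fun x => ?_,
    fun x hx => ?_⟩
  · rw [dist_eq_norm, dist_eq_norm, NNReal.coe_add, Real.coe_toNNReal _ hN0]
    rcases le_total ‖y‖ (|R| + 1) with hy | hy
    · exact hone x y hy
    rcases le_total ‖x‖ (|R| + 1) with hx | hx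
    · rw [norm_sub_rev, norm_sub_rev x]; exact hone y x hx
    · simp only [hG, cutoff_of_ge hx, cutoff_of_ge hy, zero_smul, sub_self, norm_zero]
      positivity
  · rcases le_total ‖x‖ (|R| + 1) with hx | hx
    · simp only [hG]
      rw [norm_smul, Real.norm_of_nonneg (cutoff_nonneg _ _)]
      exact (mul_le_of_le_one_left (norm_nonneg _) (cutoff_le_one _ _)).trans (hbd x hx)
    · simp only [hG, cutoff_of_ge hx, zero_smul, norm_zero]
      exact hN0
  · simp only [hG, cutoff_of_le (hx.trans (le_abs_self R)), one_smul]

lemma LipschitzOnBounded.exists_norm_le {g : X → X} (hg : LipschitzOnBounded g) (R : ℝ) :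
    ∃ N, 0 ≤ N ∧ ∀ x, ‖x‖ ≤ R → ‖g x‖ ≤ N := by
  obtain ⟨G, -, N, -, hGN, hGg⟩ := hg.exists_truncation R
  exact ⟨N, (norm_nonneg _).trans (hGN 0), fun x hx => hGg x hx ▸ hGN x⟩

end Cutoff

section Existence

variable {X : Type*} [NormedAddCommGroup X] [NormedSpace ℝ X] [CompleteSpace X]
  {E : C0Semigroup X} {w : ℝ → X} {s M : ℝ}

/-- Global existence for a bounded, globally Lipschitz nonlinearity: Picard iteration for
`v(t) = e^{-λ(t-s)} x(t)` in the bounded continuous functions, with `λ` above the Lipschitz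
constant. -/
lemma exists_isSol_of_lipschitzWith (hE : ∀ t, ‖E.op t‖ ≤ 1) {G : X → X} {L : ℝ≥0} {N : ℝ}
    (hGL : LipschitzWith L G) (hGN : ∀ x, ‖G x‖ ≤ N) (hw : IsForcing w M) (hM : 0 ≤ M)
    (hs : 0 ≤ s) (xs : X) :
    ∃ x : ℝ → X, x s = xs ∧ ∀ b, IsSol E G w s b x := by
  have hN : 0 ≤ N := (norm_nonneg _).trans (hGN 0)
  set l : ℝ := L + 1 with hl
  have hlpos : 0 < l := by positivity
  set F : (BoundedContinuousFunction ℝ X) → ℝ → X :=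
    fun v r => G (Real.exp (l * (r - s)) • v r) + w r with hF
  have hGc : ∀ v : BoundedContinuousFunction ℝ X,
      Continuous fun r => G (Real.exp (l * (r - s)) • v r) := fun v =>
    hGL.continuous.comp (by have := v.continuous; fun_prop)
  have hFi : ∀ v b, s ≤ b → IntervalIntegrable (F v) volume s b := fun v b hb =>
    ((hGc v).intervalIntegrable _ _).add (hw.intervalIntegrable hs hb)
  have hconv : ∀ v t, s ≤ t → ‖E.conv (F v) s t‖ ≤ (N + M) * (t - s) := by
    intro v t ht
    refine E.norm_integral_op_le hE ht ?_ t
    filter_upwards [hw.ae_Ioc hs (b := t)] with r hr hr'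
    exact (norm_add_le _ _).trans (add_le_add (hGN _) (hr hr'))
  set P : (BoundedContinuousFunction ℝ X) → ℝ → X := fun v t =>
    Real.exp (-(l * (t - s))) • (E.op (t - s).toNNReal xs + E.conv (F v) s t) with hP
  have hPc : ∀ v, ContinuousOn (P v) (Ici s) := by
    intro v t ht
    have h1 : ContinuousWithinAt (fun t => E.conv (F v) s t) (Ici s) t := by
      have := E.continuousOn_conv hE (hFi v (t + 1) (by linarith [mem_Ici.1 ht]))
        (by linarith [mem_Ici.1 ht]) t ⟨ht, by linarith⟩
      refine this.mono_of_mem_nhdsWithin ?_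
      rw [← Ici_inter_Iic]
      exact inter_mem_nhdsWithin _ (Iic_mem_nhds (by linarith))
    have h2 : Continuous fun t : ℝ => E.op (t - s).toNNReal xs :=
      (E.continuous_orbit xs).comp (by fun_prop)
    have h3 : Continuous fun t : ℝ => Real.exp (-(l * (t - s))) := by fun_prop
    exact h3.continuousWithinAt.smul (h2.continuousWithinAt.add h1)
  have hPb : ∀ v t, s ≤ t → ‖P v t‖ ≤ ‖xs‖ + (N + M) := by
    intro v t ht
    have h0 : 0 ≤ t - s := sub_nonneg.2 ht
    have h1 : Real.exp (-(l * (t - s))) * (t - s) ≤ 1 := by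
      rw [Real.exp_neg, inv_mul_le_iff₀ (Real.exp_pos _), mul_one]
      have := Real.add_one_le_exp (l * (t - s))
      have : 0 ≤ (L : ℝ) * (t - s) := by positivity
      rw [hl] at *
      linarith
    have h2 : Real.exp (-(l * (t - s))) ≤ 1 := by
      rw [Real.exp_le_one_iff]; simp only [Left.neg_nonpos_iff]; positivity
    simp only [hP]
    rw [norm_smul, Real.norm_of_nonneg (Real.exp_pos _).le]
    calc Real.exp (-(l * (t - s))) * ‖E.op (t - s).toNNReal xs + E.conv (F v) s t‖
        ≤ Real.exp (-(l * (t - s))) * (‖xs‖ + (N + M) * (t - s)) := by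
          gcongr
          exact (norm_add_le _ _).trans (add_le_add (E.norm_op_apply_le hE _ _) (hconv v t ht))
      _ = Real.exp (-(l * (t - s))) * ‖xs‖
          + (N + M) * (Real.exp (-(l * (t - s))) * (t - s)) := by ring
      _ ≤ 1 * ‖xs‖ + (N + M) * 1 := by gcongr
      _ = _ := by ring
  set Φ : BoundedContinuousFunction ℝ X → BoundedContinuousFunction ℝ X := fun v =>
    BoundedContinuousFunction.ofNormedAddCommGroup (fun t => P v (max t s))
      ((hPc v).comp_continuous (by fun_prop) fun t => mem_Ici.2 (le_max_right _ _)) (‖xs‖ + (N + M))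
      (fun t => hPb v _ (le_max_right _ _)) with hΦ
  set q : ℝ≥0 := L / (L + 1) with hq
  have hΦL : ContractingWith q Φ := by
    refine ⟨?_, LipschitzWith.of_dist_le_mul fun v v' => ?_⟩
    · rw [hq, div_lt_one (by positivity)]
      exact lt_add_one L
    rw [BoundedContinuousFunction.dist_le (by positivity)]
    intro t₀
    set t := max t₀ s with ht_def
    have ht : s ≤ t := le_max_right _ _
    change dist (P v t) (P v' t) ≤ _
    have hdiff : ‖E.conv (F v) s t - E.conv (F v') s t‖
        ≤ ∫ r in s..t, L * (Real.exp (l * (r - s)) * dist v v') := by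
      rw [C0Semigroup.conv, C0Semigroup.conv, ← intervalIntegral.integral_sub
        (E.intervalIntegrable_op hE (hFi v t ht) t) (E.intervalIntegrable_op hE (hFi v' t ht) t)]
      refine intervalIntegral.norm_integral_le_of_norm_le ht (Eventually.of_forall fun r hr => ?_)
        (Continuous.intervalIntegrable (by fun_prop) _ _)
      rw [← map_sub]
      refine (E.norm_op_apply_le hE _ _).trans ?_
      simp only [hF, add_sub_add_right_eq_sub]
      rw [← dist_eq_norm]
      refine (hGL.dist_le_mul _ _).trans ?_
      gcongr
      rw [dist_smul₀, Real.norm_of_nonneg (Real.exp_pos _).le]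
      gcongr
      exact BoundedContinuousFunction.dist_coe_le_dist r
    have hint : ∫ r in s..t, L * (Real.exp (l * (r - s)) * dist v v')
        = L * ((Real.exp (l * (t - s)) - 1) / l * dist v v') := by
      rw [intervalIntegral.integral_const_mul, intervalIntegral.integral_mul_const]
      congr 2
      rw [intervalIntegral.integral_eq_sub_of_hasDerivAt
        (f := fun r => Real.exp (l * (r - s)) / l) (fun r _ => ?_)
        (Continuous.intervalIntegrable (by fun_prop) _ _)]
      · simp only [sub_self, mul_zero, Real.exp_zero]; ring
      · refine ((((hasDerivAt_id r).sub_const s).const_mul l).exp.div_const l).congr_deriv ?_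
        simp only [id]
        field_simp
    rw [dist_eq_norm]
    simp only [hP]
    rw [← smul_sub, add_sub_add_left_eq_sub, norm_smul, Real.norm_of_nonneg (Real.exp_pos _).le]
    calc Real.exp (-(l * (t - s))) * ‖E.conv (F v) s t - E.conv (F v') s t‖
        ≤ Real.exp (-(l * (t - s))) * (L * ((Real.exp (l * (t - s)) - 1) / l * dist v v')) := by
          gcongr; exact hdiff.trans_eq hint
      _ ≤ Real.exp (-(l * (t - s))) * (L * (Real.exp (l * (t - s)) / l * dist v v')) := by
          gcongr; linarith
      _ = q * dist v v' := by
          rw [Real.exp_neg, hq, NNReal.coe_div, NNReal.coe_add, NNReal.coe_one, ← hl]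
          field_simp
  obtain ⟨v, hv⟩ : ∃ v, Φ v = v := ⟨_, hΦL.fixedPoint_isFixedPt⟩
  have hv' : ∀ t, s ≤ t → v t = P v t := by
    intro t ht
    have : Φ v t = P v (max t s) := rfl
    rw [hv, max_eq_left ht] at this
    exact this
  have hx : ∀ t, s ≤ t → Real.exp (l * (t - s)) • v t
      = E.op (t - s).toNNReal xs + E.conv (F v) s t := by
    intro t ht
    rw [hv' t ht]
    simp only [hP]
    rw [smul_smul, ← Real.exp_add, add_neg_cancel, Real.exp_zero, one_smul]
  have hxs : Real.exp (l * (s - s)) • v s = xs := by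
    rw [hx s le_rfl]; simp [E.op_zero_apply, E.conv_self]
  refine ⟨fun t => Real.exp (l * (t - s)) • v t, hxs, fun b => ⟨?_, fun t ht => ?_⟩⟩
  · exact Continuous.continuousOn (by have := v.continuous; fun_prop)
  · rw [hx t ht.1, hxs]

end Existence

section Existence

variable {X : Type*} [NormedAddCommGroup X] [InnerProductSpace ℝ X] [CompleteSpace X]
  {E : C0Semigroup X} {w : ℝ → X} {s M ω ω' C : ℝ} {g : X → X}

/-- Global existence for dissipative nonlinearities that are Lipschitz on bounded sets. By the
energy estimate, the solution for a truncated nonlinearity stays where the truncation is not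
felt. -/
lemma exists_isSol (hE : ∀ t, ‖E.op t‖ ≤ 1)
    (hdecay : ∀ t : ℝ≥0, ‖E.op t‖ ≤ Real.exp (-ω * t)) (hω : ω' < ω) (hC : 0 ≤ C)
    (hg : LipschitzOnBounded g) (hdamp : ∀ x, inner ℝ x (g x) ≤ C + ω' * ‖x‖ ^ 2)
    (hw : IsForcing w M) (hM : 0 ≤ M) (hs : 0 ≤ s) (xs : X) :
    ∃ x : ℝ → X, x s = xs ∧ ∀ b, IsSol E g w s b x := by
  set R2 := ‖xs‖ ^ 2 + absorbSq (ω - ω') C M + 1 with hR2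
  have hK := absorbSq_nonneg (sub_pos.2 hω) hC M
  obtain ⟨G, L, N, hGL, hGN, hGg⟩ := hg.exists_truncation (Real.sqrt R2)
  obtain ⟨x, hxs, hx⟩ := exists_isSol_of_lipschitzWith hE hGL hGN hw hM hs xs
  have hGg' : ∀ y, ‖y‖ ^ 2 ≤ R2 → G y = g y := fun y hy => hGg y (Real.le_sqrt_of_sq_le hy)
  refine ⟨x, hxs, fun b => (hx b).congr_data (fun t ht => ?_) (by simp)⟩
  refine (hGg' _ ?_).symm
  have h1 := (hx b).norm_sq_le hE hdecay hω hC hGL.continuous hw hs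
    (by rw [hxs]; intro y hy; rw [hGg' y hy]; exact hdamp y) t ht
  have h2 : Real.exp (-(ω - ω') * (t - s)) * ‖x s‖ ^ 2 ≤ 1 * ‖x s‖ ^ 2 := by
    gcongr
    rw [Real.exp_le_one_iff]
    nlinarith [ht.1]
  rw [hxs] at h1 h2
  rw [hR2]
  linarith

end Existence

/-! ### Translation of inputs -/

section Inputs

variable {U : Type*} [NormedAddCommGroup U]

lemma ae_norm_le_norm_lInfty (u : LInfty U) : ∀ᵐ r ∂halfLine, ‖u r‖ ≤ ‖u‖ := by
  filter_upwards [ae_le_eLpNormEssSup (f := u) (μ := halfLine)] with r hr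
  have h := Lp.enorm_def u
  rw [eLpNorm_exponent_top] at h
  rw [← h] at hr
  exact enorm_le_iff_norm_le.1 hr

lemma quasiMeasurePreserving_add_halfLine (h : ℝ≥0) :
    Measure.QuasiMeasurePreserving (fun t : ℝ => t + h) halfLine halfLine :=
  (measurePreserving_add_halfLine h).quasiMeasurePreserving.mono_right
    (Measure.restrict_mono_set _ (Ici_subset_Ici.2 h.coe_nonneg)).absolutelyContinuous

lemma norm_shift_le (h : ℝ≥0) (u : LInfty U) : ‖shift h u‖ ≤ ‖u‖ := by
  rw [← enorm_le_iff_norm_le, Lp.enorm_def, eLpNorm_exponent_top]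
  refine eLpNormEssSup_le_of_ae_enorm_bound ?_
  filter_upwards [coeFn_shift h u,
    (quasiMeasurePreserving_add_halfLine h).ae (ae_norm_le_norm_lInfty u)] with r hr1 hr2
  rw [hr1, enorm_le_iff_norm_le]
  exact hr2

/-- A translate to the left of a compactly supported step function on `[0, ∞)` is again one. -/
lemma IsCompactStep.comp_add {f : ℝ → U} (hf : IsCompactStep f) {h : ℝ} (hh : 0 ≤ h) :
    IsCompactStep fun r => f (r + h) := by
  obtain ⟨m, t, ht, ht0, hc, hz⟩ := hf
  rcases le_or_gt (t (Fin.last m)) h with hlast | hlast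
  · refine ⟨0, fun _ => 0, fun i j hij => absurd hij (by simp [Fin.fin_one_eq_zero]), rfl,
      fun i => i.elim0, fun r hr => hz _ ?_⟩
    simp only [mem_Ioi] at hr ⊢
    linarith
  -- `j` is the last node that does not exceed `h`; it is replaced by the new initial node `0`.
  set j := Nat.findGreatest (fun k => ∀ hk : k < m + 1, t ⟨k, hk⟩ ≤ h) m with hj
  have hj1 : ∀ hk : j < m + 1, t ⟨j, hk⟩ ≤ h :=
    Nat.findGreatest_spec (P := fun k => ∀ hk : k < m + 1, t ⟨k, hk⟩ ≤ h) (Nat.zero_le m)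
      (fun _ => ht0.trans_le hh)
  have hjm : j ≤ m := Nat.findGreatest_le m
  have hjm' : j < m := by
    refine lt_of_le_of_ne hjm fun e => absurd (hj1 (by omega)) (not_le.2 ?_)
    convert hlast using 2
    exact Fin.ext e
  have hj2 : ∀ k (hk : k < m + 1), j < k → h < t ⟨k, hk⟩ := by
    intro k hk hjk
    have := Nat.findGreatest_is_greatest (P := fun k => ∀ hk : k < m + 1, t ⟨k, hk⟩ ≤ h) hjk
      (Nat.lt_succ_iff.1 hk)
    push Not at this
    exact this.2
  refine ⟨m - j, fun k => max 0 (t ⟨j + k, by omega⟩ - h), fun a b hab => ?_, ?_,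
    fun i => ?_, fun r hr => ?_⟩
  · have hab' : (a : ℕ) < b := hab
    have hb := hj2 (j + b) (by omega) (by omega)
    have hlt : t ⟨j + a, by omega⟩ < t ⟨j + b, by omega⟩ := ht (by simpa using hab')
    exact max_lt (lt_max_of_lt_right (by linarith)) (lt_max_of_lt_right (by linarith))
  · simp only [Fin.val_zero, add_zero]
    exact max_eq_left (by linarith [hj1 (by omega)])
  · obtain ⟨c, hc'⟩ := hc ⟨j + i, by omega⟩
    refine ⟨c, fun r hr => hc' _ ⟨?_, ?_⟩⟩
    · have := (le_max_right _ _).trans_lt hr.1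
      simp only [Fin.val_castSucc] at this
      change t ⟨j + i, _⟩ < r + h
      linarith
    · have h1 := hr.2
      simp only [Fin.val_succ] at h1
      rw [max_eq_right (by linarith [hj2 (j + (i + 1)) (by omega) (by omega)])] at h1
      change r + h < t ⟨j + (i + 1), _⟩
      linarith
  · apply hz
    have := (le_max_right _ _).trans_lt (mem_Ioi.1 hr)
    simp only [Fin.val_last] at this
    have e : (⟨j + (m - j), by omega⟩ : Fin (m + 1)) = Fin.last m := Fin.ext (by simp; omega)
    rw [e] at this
    simp only [mem_Ioi]
    linarith

lemma shift_mem_sInfty (h : ℝ≥0) {u : LInfty U} (hu : u ∈ SInfty U) : shift h u ∈ SInfty U := by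
  obtain ⟨f, hf, hlim⟩ := hu
  refine ⟨fun n r => f n (r + h), fun n => (hf n).comp_add h.coe_nonneg, fun t₀ ht₀ => ?_⟩
  refine tendsto_of_tendsto_of_tendsto_of_le_of_le tendsto_const_nhds
    (hlim (t₀ + h) (by positivity)) (fun _ => bot_le) fun n => ?_
  simp only [eLpNorm_exponent_top]
  refine eLpNormEssSup_le_of_ae_enorm_bound ?_
  have h1 := ae_le_eLpNormEssSup (f := fun r => f n r - u r)
    (μ := volume.restrict (Icc 0 (t₀ + h)))
  rw [ae_restrict_iff' measurableSet_Icc] at h1 ⊢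
  have h2 := (measurePreserving_add_right (volume : Measure ℝ) h).quasiMeasurePreserving.ae h1
  have h3 := (ae_restrict_iff' measurableSet_Ici).1 (coeFn_shift h u)
  filter_upwards [h2, h3] with r hr2 hr3 hr
  rw [hr3 hr.1]
  exact hr2 ⟨add_nonneg hr.1 h.coe_nonneg, by linarith [hr.2]⟩

lemma mapsTo_shift_inputSpace (h : ℝ≥0) (r₀ : ℝ) :
    MapsTo (shift h) (inputSpace U r₀) (inputSpace U r₀) := by
  rintro u ⟨hu1, hu2⟩
  refine ⟨shift_mem_sInfty h hu1, ?_⟩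
  rw [mem_closedBall_zero_iff] at hu2 ⊢
  exact (norm_shift_le h u).trans hu2

variable [NormedSpace ℝ U] {X : Type*} [NormedAddCommGroup X] [NormedSpace ℝ X]

lemma isForcing_input (h : U →L[ℝ] X) (u : LInfty U) :
    IsForcing (fun r => h (u r)) (‖h‖ * ‖u‖) := by
  refine ⟨h.continuous.comp_aestronglyMeasurable (Lp.aestronglyMeasurable u), ?_⟩
  filter_upwards [ae_norm_le_norm_lInfty u] with r hr
  exact h.le_opNorm_of_le hr

lemma isForcing_input_of_mem {r₀ : ℝ} (h : U →L[ℝ] X) {u : LInfty U} (hu : u ∈ inputSpace U r₀) :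
    IsForcing (fun r => h (u r)) (‖h‖ * r₀) := by
  refine (isForcing_input h u).mono ?_
  have := mem_closedBall_zero_iff.1 hu.2
  gcongr

end Inputs

/-! ### The solution semiprocess -/

section MildSolutions

variable {X : Type*} [NormedAddCommGroup X] [NormedSpace ℝ X] {U : Type*} [NormedAddCommGroup U]
  [NormedSpace ℝ U] {E : C0Semigroup X} {g : X → X} {h : U →L[ℝ] X} {v : ℝ → U} {s b : ℝ}
  {xs : X} {x : ℝ → X} {τ : EReal}

lemma IsMildSolution.isSol (hx : IsMildSolution E g h v s xs τ x) (hb : (b : EReal) < τ) :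
    x s = xs ∧ IsSol E g (fun r => h (v r)) s b x := by
  have hxs : x s = xs := by
    rw [hx.eq s ⟨le_rfl, hx.lt⟩]
    simp [E.op_zero_apply]
  have hsub : Icc s b ⊆ timeInterval s τ := fun t ht =>
    ⟨ht.1, (EReal.coe_le_coe_iff.2 ht.2).trans_lt hb⟩
  refine ⟨hxs, hx.continuousOn.mono hsub, fun t ht => ?_⟩
  rw [hx.eq t (hsub ht), hxs]
  rfl

lemma IsSol.isMildSolution (hE : ∀ t, ‖E.op t‖ ≤ 1) {M : ℝ} (hg : Continuous g)
    (hw : IsForcing (fun r => h (v r)) M) (hs : 0 ≤ s)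
    (hx : ∀ b, IsSol E g (fun r => h (v r)) s b x) :
    IsMildSolution E g h v s (x s) ⊤ x := by
  refine ⟨EReal.coe_lt_top s, fun t ht => ?_, fun t ht => ?_, fun t ht => ?_⟩
  · refine ((hx (t + 1)).continuousOn t ⟨ht.1, by linarith⟩).mono_of_mem_nhdsWithin ?_
    filter_upwards [self_mem_nhdsWithin, mem_nhdsWithin_of_mem_nhds
      (Iic_mem_nhds (lt_add_one t))] with r hr1 hr2 using ⟨hr1.1, hr2⟩
  · exact E.intervalIntegrable_op hE ((hx t).intervalIntegrable hg hw hs ht.1) t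
  · exact (hx t).eq t ⟨ht.1, le_rfl⟩

end MildSolutions

section Trajectories

variable {X : Type*} [NormedAddCommGroup X] [InnerProductSpace ℝ X]
  {E : C0Semigroup X} {g : X → X} {ω ω' C : ℝ}

/-- The standing assumptions on the semigroup `E` and the nonlinearity `g`: exponential decay of
`E`, and one-sided growth of `g` below the decay rate. -/
structure IsDissipative (E : C0Semigroup X) (g : X → X) (ω ω' C : ℝ) : Prop where
  lipschitz : LipschitzOnBounded g
  pos : 0 < ω
  lt : ω' < ω
  decay : ∀ t : ℝ≥0, ‖E.op t‖ ≤ Real.exp (-ω * t)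
  damp : ∀ x : X, inner ℝ x (g x) ≤ C + ω' * ‖x‖ ^ 2

lemma IsDissipative.contraction (d : IsDissipative E g ω ω' C) (t : ℝ≥0) : ‖E.op t‖ ≤ 1 := by
  refine (d.decay t).trans (Real.exp_le_one_iff.2 ?_)
  have := d.pos
  have : 0 ≤ ω * t := by positivity
  linarith

lemma IsDissipative.const_nonneg (d : IsDissipative E g ω ω' C) : 0 ≤ C := by
  simpa using d.damp 0

/-- The global solution `t ↦ x(t)` of `x' = A x + g(x) + w`, `x(s) = xs`, by choice. It is meaningful
only under the conditions of `IsDissipative.sol_spec`. -/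
noncomputable def sol (E : C0Semigroup X) (g : X → X) (w : ℝ → X) (s : ℝ) (xs : X) : ℝ → X :=
  Classical.epsilon fun x => x s = xs ∧ ∀ b, IsSol E g w s b x

variable [CompleteSpace X] {w w' x : ℝ → X} {s b c t M : ℝ} {xs : X}

lemma IsDissipative.sol_spec (d : IsDissipative E g ω ω' C) (hw : IsForcing w M) (hs : 0 ≤ s)
    (xs : X) : sol E g w s xs s = xs ∧ ∀ b, IsSol E g w s b (sol E g w s xs) :=
  Classical.epsilon_spec (exists_isSol d.contraction d.decay d.lt d.const_nonneg d.lipschitz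
    d.damp hw hw.nonneg hs xs)

lemma IsDissipative.sol_self (d : IsDissipative E g ω ω' C) (hw : IsForcing w M) (hs : 0 ≤ s)
    (xs : X) : sol E g w s xs s = xs := (d.sol_spec hw hs xs).1

lemma IsDissipative.isSol_sol (d : IsDissipative E g ω ω' C) (hw : IsForcing w M) (hs : 0 ≤ s)
    (xs : X) (b : ℝ) : IsSol E g w s b (sol E g w s xs) := (d.sol_spec hw hs xs).2 b

lemma IsDissipative.eq_sol (d : IsDissipative E g ω ω' C) (hw : IsForcing w M) (hs : 0 ≤ s)
    (hst : s ≤ t) (hx : IsSol E g w s t x) (hxs : x s = xs) : x t = sol E g w s xs t :=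
  hx.eqOn d.contraction d.lipschitz (d.isSol_sol hw hs xs t) hw hs
    (by rw [hxs, d.sol_self hw hs]) ⟨hst, le_rfl⟩

lemma IsDissipative.sol_trans (d : IsDissipative E g ω ω' C) (hw : IsForcing w M) {r : ℝ}
    (hr : 0 ≤ r) (hrs : r ≤ s) (hst : s ≤ t) (x : X) :
    sol E g w s (sol E g w r x s) t = sol E g w r x t :=
  (d.eq_sol hw (hr.trans hrs) hst ((d.isSol_sol hw hr x t).restart d.contraction
    d.lipschitz.continuous hw hr hrs) rfl).symm

lemma IsDissipative.sol_translate (d : IsDissipative E g ω ω' C) (hw : IsForcing w M) {M' : ℝ}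
    (hw' : IsForcing w' M') (hc : 0 ≤ c) (hs : 0 ≤ s) (hst : s ≤ t)
    (hww : ∀ᵐ r ∂halfLine, w' r = w (r + c)) (x : X) :
    sol E g w (s + c) x (t + c) = sol E g w' s x t := by
  have h1 := (d.isSol_sol hw (by positivity) x (t + c)).comp_add_right (s := s) (b := t) (c := c)
  have h2 : IsSol E g w' s t (fun t => sol E g w (s + c) x (t + c)) :=
    h1.congr_data (fun _ _ => rfl) (ae_mem_Ioc_of_ae_halfLine hww hs)
  exact d.eq_sol hw' hs hst h2 (d.sol_self hw (by positivity) x)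

lemma IsDissipative.norm_sq_sol_le (d : IsDissipative E g ω ω' C) (hw : IsForcing w M)
    (hs : 0 ≤ s) (hst : s ≤ t) (x : X) :
    ‖sol E g w s x t‖ ^ 2 ≤
      Real.exp (-(ω - ω') * (t - s)) * ‖x‖ ^ 2 + absorbSq (ω - ω') C M := by
  have := (d.isSol_sol hw hs x t).norm_sq_le d.contraction d.decay d.lt d.const_nonneg
    d.lipschitz.continuous hw hs (fun y _ => d.damp y) t ⟨hst, le_rfl⟩
  rwa [d.sol_self hw hs] at this

lemma IsDissipative.norm_sq_sol_le' (d : IsDissipative E g ω ω' C) (hw : IsForcing w M)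
    (hs : 0 ≤ s) (hst : s ≤ t) (x : X) :
    ‖sol E g w s x t‖ ^ 2 ≤ ‖x‖ ^ 2 + absorbSq (ω - ω') C M := by
  have h1 : Real.exp (-(ω - ω') * (t - s)) * ‖x‖ ^ 2 ≤ 1 * ‖x‖ ^ 2 := by
    gcongr
    rw [Real.exp_le_one_iff]
    nlinarith [d.lt]
  linarith [d.norm_sq_sol_le hw hs hst x]

/-- A radius such that the trajectories starting in the ball of radius `R`, with forcing terms
bounded by `M`, remain in the ball of that radius. -/
noncomputable def trapRadius (a C M R : ℝ) : ℝ := Real.sqrt (R ^ 2 + absorbSq a C M)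

lemma IsDissipative.norm_sol_le (d : IsDissipative E g ω ω' C) (hw : IsForcing w M)
    (hs : 0 ≤ s) (hst : s ≤ t) {x : X} {R : ℝ} (hx : ‖x‖ ≤ R) :
    ‖sol E g w s x t‖ ≤ trapRadius (ω - ω') C M R := by
  refine Real.le_sqrt_of_sq_le ((d.norm_sq_sol_le' hw hs hst x).trans ?_)
  gcongr

/-- The radius of an absorbing ball, for forcing terms bounded by `M`. The summand `1` makes
trajectories enter the ball in finite time. -/
noncomputable def absorbRadius (a C M : ℝ) : ℝ := Real.sqrt (absorbSq a C M + 1)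

/-- After a time that depends only on the size of the initial value, trajectories are in the
absorbing ball. -/
lemma IsDissipative.exists_absorb (d : IsDissipative E g ω ω' C) (M R : ℝ) :
    ∃ T : ℝ, 0 ≤ T ∧ ∀ (w : ℝ → X), IsForcing w M → ∀ x : X, ‖x‖ ≤ R → ∀ t, T ≤ t →
      ‖sol E g w 0 x t‖ ≤ absorbRadius (ω - ω') C M := by
  have ha : 0 < ω - ω' := sub_pos.2 d.lt
  have h1 : Tendsto (fun t : ℝ => Real.exp (-((ω - ω') * t)) * R ^ 2) atTop (𝓝 0) := by
    have := (Real.tendsto_exp_neg_atTop_nhds_zero.comp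
      (tendsto_id.const_mul_atTop ha)).mul_const (R ^ 2)
    simpa using this
  obtain ⟨T, hT⟩ := eventually_atTop.1 (h1.eventually (gt_mem_nhds one_pos))
  refine ⟨max T 0, le_max_right _ _, fun w hw x hx t ht => ?_⟩
  refine Real.le_sqrt_of_sq_le
    ((d.norm_sq_sol_le hw le_rfl ((le_max_right _ _).trans ht) x).trans ?_)
  have h2 := hT t ((le_max_left _ _).trans ht)
  have h3 : Real.exp (-(ω - ω') * (t - 0)) * ‖x‖ ^ 2
      ≤ Real.exp (-((ω - ω') * t)) * R ^ 2 := by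
    rw [sub_zero, neg_mul]
    gcongr
  linarith

/-- At a fixed time `T`, trajectories starting in a ball depend Lipschitz continuously on the initial
value and on the forcing term. -/
lemma IsDissipative.exists_norm_sol_sub_le (d : IsDissipative E g ω ω' C) (M R T : ℝ)
    (hT : 0 ≤ T) :
    ∃ k : ℝ, 0 ≤ k ∧ ∀ (w w' : ℝ → X), IsForcing w M → IsForcing w' M →
      ∀ x x' : X, ‖x‖ ≤ R → ‖x'‖ ≤ R → ∀ m, 0 ≤ m → (∀ᵐ r ∂halfLine, ‖w r - w' r‖ ≤ m) →
      ‖sol E g w 0 x T - sol E g w' 0 x' T‖ ≤ k * (‖x - x'‖ + m) := by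
  obtain ⟨L, hL⟩ := d.lipschitz _
    (Metric.isBounded_closedBall (x := (0 : X)) (r := trapRadius (ω - ω') C M R))
  refine ⟨max 1 T * Real.exp (L * T), by positivity, fun w w' hw hw' x x' hx hx' m hm hww => ?_⟩
  have h1 := (d.isSol_sol hw le_rfl x T).norm_sub_le d.contraction d.lipschitz.continuous hL
    (d.isSol_sol hw' le_rfl x' T) hw hw' le_rfl
    (fun t ht => by simpa using d.norm_sol_le hw le_rfl ht.1 hx)
    (fun t ht => by simpa using d.norm_sol_le hw' le_rfl ht.1 hx') hm
    (ae_mem_Ioc_of_ae_halfLine hww le_rfl) T ⟨hT, le_rfl⟩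
  rw [d.sol_self hw le_rfl, d.sol_self hw' le_rfl, sub_zero] at h1
  refine h1.trans ?_
  have h2 : ‖x - x'‖ + m * T ≤ max 1 T * (‖x - x'‖ + m) := by
    have i1 : 1 * ‖x - x'‖ ≤ max 1 T * ‖x - x'‖ := by gcongr; exact le_max_left _ _
    have i2 : T * m ≤ max 1 T * m := by gcongr; exact le_max_right _ _
    linarith
  calc (‖x - x'‖ + m * T) * Real.exp (L * T)
      ≤ max 1 T * (‖x - x'‖ + m) * Real.exp (L * T) := by gcongr
    _ = _ := by ring

end Trajectories

section Semiprocess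

variable {X : Type*} [NormedAddCommGroup X] [InnerProductSpace ℝ X] [CompleteSpace X]
  {U : Type*} [NormedAddCommGroup U] [NormedSpace ℝ U]
  {E : C0Semigroup X} {g : X → X} {ω ω' C : ℝ}

/-- The semiprocess `S_u(t, s, x)` of the maximal mild solutions. -/
noncomputable def solSemiprocess (E : C0Semigroup X) (g : X → X) (h : U →L[ℝ] X) (u : LInfty U)
    (t s : ℝ) (x : X) : X := sol E g (fun r => h (u r)) s x t

lemma IsDissipative.givenByMildSolutions (d : IsDissipative E g ω ω' C) (h : U →L[ℝ] X)
    (𝒰 : Set (LInfty U)) : GivenByMildSolutions E g h 𝒰 (solSemiprocess E g h) := by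
  intro u _ s hs xs
  have hw := isForcing_input h u
  have hmild : IsMildSolution E g h u s xs ⊤ (fun t => solSemiprocess E g h u t s xs) := by
    have := IsSol.isMildSolution d.contraction d.lipschitz.continuous hw hs
      (d.isSol_sol hw hs xs)
    rwa [d.sol_self hw hs] at this
  refine ⟨⟨hmild, fun τ' y _ hτ _ => top_le_iff.1 hτ⟩, fun τ y hy => ?_⟩
  have heq : ∀ t ∈ timeInterval s τ, y t = solSemiprocess E g h u t s xs := fun t ht =>
    d.eq_sol hw hs ht.1 (hy.isMildSolution.isSol ht.2).2 (hy.isMildSolution.isSol ht.2).1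
  have hτ : ⊤ = τ := hy.maximal ⊤ _ hmild le_top fun t ht => (heq t ht).symm
  refine ⟨hτ.symm, fun t ht => heq t ⟨ht, ?_⟩⟩
  rw [← hτ]
  exact EReal.coe_lt_top t

lemma IsDissipative.solSemiprocess_translate (d : IsDissipative E g ω ω' C) (h : U →L[ℝ] X)
    (u : LInfty U) (c : ℝ≥0) {s t : ℝ} (hs : 0 ≤ s) (hst : s ≤ t) (x : X) :
    solSemiprocess E g h u (t + c) (s + c) x = solSemiprocess E g h (shift c u) t s x := by
  refine d.sol_translate (isForcing_input h u) (isForcing_input h _) c.coe_nonneg hs hst ?_ x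
  filter_upwards [coeFn_shift c u] with r hr
  rw [hr]

lemma IsDissipative.isSemiprocessFamily (d : IsDissipative E g ω ω' C) (h : U →L[ℝ] X)
    (r₀ : ℝ) :
    IsSemiprocessFamily (inputSpace U r₀) shift (solSemiprocess E g h) where
  mapsTo c := mapsTo_shift_inputSpace c r₀
  refl u _ _ x hs := d.sol_self (isForcing_input h u) hs x
  trans u _ _ _ _ x hr hrs hst := d.sol_trans (isForcing_input h u) hr hrs hst x
  translate u _ c _ _ x hs hst := d.solSemiprocess_translate h u c hs hst x

lemma IsDissipative.solSemiprocess_zero (d : IsDissipative E g ω ω' C) (h : U →L[ℝ] X)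
    {t : ℝ} (ht : 0 ≤ t) (x : X) :
    solSemiprocess E g h 0 t 0 x = sol E g (fun _ => 0) 0 x t := by
  have := d.sol_translate (isForcing_input h (0 : LInfty U)) IsForcing.zero le_rfl le_rfl ht
    (c := 0) ?_ x
  · simpa [solSemiprocess] using this
  · have h0 : ((0 : LInfty U) : ℝ → U) =ᵐ[halfLine] 0 := Lp.coeFn_zero U ∞ halfLine
    filter_upwards [h0] with r hr
    rw [add_zero, hr, Pi.zero_apply, map_zero]

end Semiprocess

/-! ### The global attractor -/

section Attractor

/-- A continuous semigroup that eventually maps `B₀` into a compact set has a compact, negatively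
invariant set attracting `B₀`: the `ω`-limit set of `B₀`. -/
lemma exists_compact_attracting {X : Type*} [MetricSpace X] {φ : ℝ → X → X} {B₀ K : Set X}
    (hadd : ∀ s t, 0 ≤ s → 0 ≤ t → ∀ x, φ (s + t) x = φ s (φ t x))
    (hcont : ∀ t, 0 ≤ t → Continuous (φ t)) (hK : IsCompact K)
    (hφK : ∀ᶠ t in atTop, ∀ x ∈ B₀, φ t x ∈ K) :
    ∃ Θ : Set X, IsCompact Θ ∧
      (∀ V, IsOpen V → Θ ⊆ V → ∀ᶠ t in atTop, ∀ x ∈ B₀, φ t x ∈ V) ∧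
      ∀ t, 0 ≤ t → Θ ⊆ φ t '' Θ := by
  set F : Filter (ℝ × X) := atTop ×ˢ 𝓟 B₀ with hF
  set Φ : ℝ × X → X := fun p => φ p.1 p.2 with hΦ
  have hev : ∀ p : ℝ → X → Prop, (∀ᶠ t in atTop, ∀ x ∈ B₀, p t x) ↔ ∀ᶠ q in F, p q.1 q.2 := by
    intro p
    rw [hF, eventually_prod_principal_iff]
  have hFK : ∀ᶠ p in F, Φ p ∈ K := (hev fun t x => φ t x ∈ K).1 hφK
  set Θ : Set X := {y | MapClusterPt y F Φ} with hΘ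
  have hmem : ∀ {𝒰 : Ultrafilter (ℝ × X)} {Ψ : ℝ × X → X}, (∀ᶠ p in 𝒰, Ψ p ∈ K) →
      ∃ y ∈ K, Tendsto Ψ 𝒰 (𝓝 y) := by
    intro 𝒰 Ψ h
    exact hK.ultrafilter_le_nhds (𝒰.map Ψ) (le_principal_iff.2 h)
  have hΘK : Θ ⊆ K := by
    intro y hy
    obtain ⟨𝒰, h𝒰, hlim⟩ := mapClusterPt_iff_ultrafilter.1 hy
    exact hK.isClosed.mem_of_tendsto hlim (h𝒰 hFK)
  refine ⟨Θ, hK.of_isClosed_subset isClosed_setOfPred_clusterPt hΘK, fun V hV hΘV => ?_,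
    fun t ht y hy => ?_⟩
  · rw [hev fun t x => φ t x ∈ V]
    by_contra hcon
    have : (F ⊓ 𝓟 {p | Φ p ∉ V}).NeBot := by
      rw [← frequently_mem_iff_neBot]
      exact fun hh => hcon (hh.mono fun p hp => not_not.1 hp)
    obtain ⟨𝒰, h𝒰⟩ := Ultrafilter.exists_le (F ⊓ 𝓟 {p | Φ p ∉ V})
    obtain ⟨h𝒰F, h𝒰V⟩ := le_inf_iff.1 h𝒰
    obtain ⟨y, -, hlim⟩ := hmem (h𝒰F hFK)
    have hy : y ∈ Θ := mapClusterPt_iff_ultrafilter.2 ⟨𝒰, h𝒰F, hlim⟩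
    obtain ⟨p, hp1, hp2⟩ := ((hlim.eventually (hV.mem_nhds (hΘV hy))).and
      (le_principal_iff.1 h𝒰V)).exists
    exact hp2 hp1
  · -- Follow the trajectories that approach `y` back by time `t`.
    obtain ⟨𝒰, h𝒰, hlim⟩ := mapClusterPt_iff_ultrafilter.1 hy
    set σ : ℝ × X → ℝ × X := fun p => (p.1 - t, p.2) with hσ
    have hσF : Tendsto σ F F := by
      refine Tendsto.prodMk ((tendsto_atTop_add_const_right _ (-t) tendsto_fst)) tendsto_snd
    have hσ𝒰 : Tendsto σ 𝒰 F := hσF.mono_left h𝒰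
    obtain ⟨z, -, hz⟩ := hmem (Ψ := Φ ∘ σ) (hσ𝒰.eventually hFK)
    refine ⟨z, mapClusterPt_iff_ultrafilter.2 ⟨𝒰.map σ, hσ𝒰, tendsto_map'_iff.2 hz⟩, ?_⟩
    refine tendsto_nhds_unique (((hcont t ht).tendsto z).comp hz) (hlim.congr' ?_)
    have hlarge : ∀ᶠ p in F, t ≤ p.1 := tendsto_fst.eventually (eventually_ge_atTop t)
    filter_upwards [h𝒰 hlarge] with p hp
    have := hadd t (p.1 - t) ht (sub_nonneg.2 hp) p.2
    rw [add_sub_cancel] at this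
    exact this

/-- A global attractor is unique, since each one attracts the other. -/
lemma IsGlobalAttractor.eq {X V : Type*} [NormedAddCommGroup X] {S : V → ℝ → ℝ → X → X}
    {𝒱 : Set V} {Θ Θ' : Set X} (h : IsGlobalAttractor S 𝒱 Θ) (h' : IsGlobalAttractor S 𝒱 Θ') :
    Θ = Θ' := by
  have key : ∀ {Θ Θ' : Set X}, IsGlobalAttractor S 𝒱 Θ → IsGlobalAttractor S 𝒱 Θ' →
      Θ ⊆ Θ' := by
    intro Θ Θ' h h' y hy
    rw [← h'.isCompact.isClosed.closure_eq, Metric.mem_closure_iff_infEDist_zero]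
    refine le_antisymm (ge_of_tendsto (h'.attractive Θ h.isCompact.isBounded) ?_) bot_le
    filter_upwards [eventually_ge_atTop 0] with t ht
    exact le_iSup₂_of_le y (h.negInvariant t ht hy) le_rfl
  exact (key h h').antisymm (key h' h)

lemma setSemiprocess_singleton {X V : Type*} (S : V → ℝ → ℝ → X → X) (v : V) (t s : ℝ)
    (M : Set X) : setSemiprocess S {v} t s M = S v t s '' M := by
  ext y
  simp [setSemiprocess]

variable {X : Type*} [NormedAddCommGroup X] [InnerProductSpace ℝ X] [CompleteSpace X]
  {E : C0Semigroup X} {g : X → X} {ω ω' C : ℝ}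

/-- For positive times the solution map is compact: up to an error of order `ε`, the state at time
`1` is the image under the compact operator `E(ε)` of the state at time `1 - ε`. -/
lemma IsDissipative.exists_compact_sol_one (d : IsDissipative E g ω ω' C)
    (hEc : E.IsCompactSemigroup) (R : ℝ) :
    ∃ K, IsCompact K ∧ ∀ x, ‖x‖ ≤ R → sol E g (fun _ => 0) 0 x 1 ∈ K := by
  set A : Set X := (fun x => sol E g (fun _ => 0) 0 x 1) '' Metric.closedBall 0 R with hA
  suffices hTB : TotallyBounded A from
    ⟨closure A, hTB.closure.isCompact_of_isClosed isClosed_closure,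
      fun x hx => subset_closure (mem_image_of_mem _ (by simpa using hx))⟩
  set R₁ := trapRadius (ω - ω') C 0 R with hR₁
  obtain ⟨N, hN, hgN⟩ := d.lipschitz.exists_norm_le R₁
  rw [Metric.totallyBounded_iff]
  intro ε hε
  set η : ℝ := min 1 (ε / (2 * (N + 1))) with hη
  have hη0 : 0 < η := by positivity
  have hη1 : η ≤ 1 := min_le_left _ _
  have hηN : N * η < ε / 2 := by
    have h1 : η * (2 * (N + 1)) ≤ ε := by
      rw [← le_div_iff₀ (by positivity)]; exact min_le_right _ _
    nlinarith
  have hcomp := (hEc η.toNNReal (by simpa using hη0)).isCompact_closure_image_closedBall R₁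
  obtain ⟨T, hT, hcov⟩ := Metric.totallyBounded_iff.1 hcomp.totallyBounded (ε / 2) (by positivity)
  refine ⟨T, hT, ?_⟩
  rintro _ ⟨x, hx, rfl⟩
  rw [mem_closedBall_zero_iff] at hx
  set z := sol E g (fun _ => 0) 0 x with hz
  have hzn : ∀ t, 0 ≤ t → ‖z t‖ ≤ R₁ := fun t ht => d.norm_sol_le IsForcing.zero le_rfl ht hx
  have h1 := (d.isSol_sol IsForcing.zero le_rfl x 1).eq_restart d.contraction
    d.lipschitz.continuous IsForcing.zero le_rfl (c := 1 - η) (t := 1) (by linarith)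
    (by linarith) le_rfl
  rw [sub_sub_cancel, ← hz] at h1
  have h2 : ‖E.conv (fun r => g (z r) + 0) (1 - η) 1‖ ≤ N * (1 - (1 - η)) := by
    refine E.norm_integral_op_le d.contraction (by linarith) (Eventually.of_forall fun r hr => ?_) 1
    rw [add_zero]
    exact hgN _ (hzn r (by linarith [hr.1]))
  obtain ⟨y, hyT, hy⟩ := mem_iUnion₂.1 (hcov (subset_closure
    (mem_image_of_mem (E.op η.toNNReal) (mem_closedBall_zero_iff.2 (hzn (1 - η) (by linarith))))))
  refine mem_iUnion₂.2 ⟨y, hyT, ?_⟩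
  rw [mem_ball_iff_norm] at hy ⊢
  change ‖z 1 - y‖ < ε
  rw [h1, add_sub_right_comm]
  refine (norm_add_le _ _).trans_lt ?_
  rw [sub_sub_cancel] at h2
  linarith

/-- The undisturbed semiprocess has a global attractor. -/
lemma IsDissipative.exists_isGlobalAttractor {U : Type*} [NormedAddCommGroup U]
    [NormedSpace ℝ U] (d : IsDissipative E g ω ω' C) (hEc : E.IsCompactSemigroup)
    (h : U →L[ℝ] X) : ∃ Θ, IsGlobalAttractor (solSemiprocess E g h) {0} Θ := by
  set φ : ℝ → X → X := fun t x => sol E g (fun _ => 0) 0 x t with hφ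
  have hadd : ∀ s t, 0 ≤ s → 0 ≤ t → ∀ x, φ (s + t) x = φ s (φ t x) := by
    intro s t hs ht x
    have h1 := d.sol_trans IsForcing.zero le_rfl ht (t := s + t) (by linarith) x
    have h2 := d.sol_translate IsForcing.zero IsForcing.zero ht le_rfl hs
      (Eventually.of_forall fun _ => rfl) (φ t x)
    rw [zero_add] at h2
    exact h1.symm.trans h2
  have hcont : ∀ t, 0 ≤ t → Continuous (φ t) := by
    intro t ht
    rw [continuous_iff_continuousAt]
    intro x
    obtain ⟨k, hk, hkl⟩ := d.exists_norm_sol_sub_le 0 (‖x‖ + 1) t ht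
    rw [ContinuousAt, tendsto_iff_norm_sub_tendsto_zero]
    have hlim : Tendsto (fun y => k * (‖y - x‖ + 0)) (𝓝 x) (𝓝 0) := by
      have : Continuous fun y => k * (‖y - x‖ + 0) := by fun_prop
      simpa using this.tendsto x
    refine squeeze_zero' (Eventually.of_forall fun _ => norm_nonneg _) ?_ hlim
    filter_upwards [Metric.ball_mem_nhds x one_pos] with y hy
    rw [mem_ball_iff_norm] at hy
    refine hkl _ _ IsForcing.zero IsForcing.zero y x ?_ (by linarith) 0 le_rfl (by simp)
    linarith [norm_le_insert' y x]
  set R₀ := absorbRadius (ω - ω') C 0 with hR₀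
  have habs : ∀ R, ∃ T, 0 ≤ T ∧ ∀ x, ‖x‖ ≤ R → ∀ t, T ≤ t → ‖φ t x‖ ≤ R₀ := by
    intro R
    obtain ⟨T, hT0, hT⟩ := d.exists_absorb 0 R
    exact ⟨T, hT0, hT _ IsForcing.zero⟩
  obtain ⟨K, hK, hφK⟩ := d.exists_compact_sol_one hEc R₀
  obtain ⟨T₀, hT₀, habs₀⟩ := habs R₀
  obtain ⟨Θ, hΘc, hΘa, hΘi⟩ := exists_compact_attracting (B₀ := Metric.closedBall 0 R₀) hadd
    hcont hK (by
      filter_upwards [eventually_ge_atTop (1 + T₀)] with t ht x hx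
      have h1 := hadd 1 (t - 1) zero_le_one (by linarith) x
      rw [add_sub_cancel] at h1
      rw [h1]
      exact hφK _ (habs₀ x (by simpa using hx) _ (by linarith)))
  have hS : ∀ t, 0 ≤ t → ∀ B, setSemiprocess (solSemiprocess E g h) {0} t 0 B = φ t '' B := by
    intro t ht B
    rw [setSemiprocess_singleton]
    exact image_congr fun x _ => d.solSemiprocess_zero h ht x
  refine ⟨Θ, hΘc, fun B hB => ?_, fun t ht => (hS t ht Θ).symm ▸ hΘi t ht⟩
  obtain ⟨R, hR⟩ := hB.exists_norm_le
  obtain ⟨T₁, hT₁, habs₁⟩ := habs R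
  rw [ENNReal.tendsto_nhds_zero]
  intro ε hε
  have hV := hΘa {y | Metric.infEDist y Θ < ε}
    (isOpen_lt Metric.continuous_infEDist continuous_const)
    (fun y hy => by simpa [Metric.infEDist_zero_of_mem hy] using hε)
  obtain ⟨T₂, hT₂⟩ := eventually_atTop.1 hV
  filter_upwards [eventually_ge_atTop (max T₂ 0 + T₁)] with t ht
  have ht1 : 0 ≤ t - T₁ := by linarith [le_max_right T₂ 0]
  have ht2 : T₂ ≤ t - T₁ := by linarith [le_max_left T₂ 0]
  rw [hS t (by linarith)]
  refine iSup₂_le ?_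
  rintro _ ⟨x, hx, rfl⟩
  have h1 := hadd (t - T₁) T₁ ht1 hT₁ x
  rw [sub_add_cancel] at h1
  rw [h1]
  exact (hT₂ _ ht2 _ (by simpa using habs₁ x (hR x hx) T₁ le_rfl)).le

end Attractor

/-! ### Asymptotic gain -/

/-- A bounded function that tends to `0` at `0` is dominated by a function of class `𝒦`. -/
lemma exists_isClassK {β : ℝ≥0 → ℝ≥0∞} {M : ℝ≥0} (hM : 0 < M) (hβM : ∀ r, β r ≤ M)
    (hβ : ∀ ε : ℝ≥0, 0 < ε → ∃ δ : ℝ≥0, 0 < δ ∧ ∀ r, r < δ → β r ≤ ε) :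
    ∃ γ : ℝ≥0 → ℝ≥0, IsClassK γ ∧ ∀ r, β r ≤ γ r := by
  -- `γ(r) = r + ∑ n, M 2⁻ⁿ min (1, r / δ n)`, where `β ≤ M 2⁻ⁿ⁻¹` on `[0, δ n)`.
  choose δ hδ hβδ using fun n : ℕ => hβ (M * (1 / 2) ^ (n + 1)) (by positivity)
  set f : ℕ → ℝ≥0 → ℝ := fun n r => M * (1 / 2) ^ n * min 1 ((r : ℝ) / δ n) with hf
  have hδ' : ∀ n, (0 : ℝ) < δ n := fun n => NNReal.coe_pos.2 (hδ n)
  have hf0 : ∀ n r, 0 ≤ f n r := fun n r => by simp only [hf]; positivity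
  have hfle : ∀ n r, f n r ≤ M * (1 / 2) ^ n := fun n r => by
    simp only [hf]
    exact mul_le_of_le_one_right (by positivity) (min_le_left _ _)
  have hsum : Summable fun n : ℕ => (M : ℝ) * (1 / 2) ^ n := summable_geometric_two.mul_left _
  have hfs : ∀ r, Summable fun n => f n r := fun r =>
    Summable.of_nonneg_of_le (fun n => hf0 n r) (fun n => hfle n r) hsum
  have hcont : Continuous fun r => ∑' n, f n r := by
    refine continuous_tsum (fun n => ?_) hsum (fun n r => ?_)
    · simp only [hf]; fun_prop
    · rw [Real.norm_of_nonneg (hf0 n r)]; exact hfle n r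
  have hmono : Monotone fun r => ∑' n, f n r := by
    intro r r' hr
    refine (hfs r).tsum_le_tsum (fun n => ?_) (hfs r')
    simp only [hf]
    gcongr
  refine ⟨fun r => r + (∑' n, f n r).toNNReal, ⟨by fun_prop, ?_, ?_⟩, fun r => ?_⟩
  · exact strictMono_id.add_monotone fun a b hab => Real.toNNReal_mono (hmono hab)
  · simp [hf]
  by_cases hex : ∃ n, δ n ≤ r
  · classical
    set n := Nat.find hex with hn
    have hβn : β r ≤ ((M * (1 / 2) ^ n : ℝ≥0) : ℝ≥0∞) := by
      rcases Nat.eq_zero_or_pos n with h0 | hpos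
      · rw [h0]; simpa using hβM r
      · have h1 := Nat.find_min hex (m := n - 1) (by omega)
        have h2 := hβδ (n - 1) r (not_le.1 h1)
        rwa [Nat.sub_add_cancel hpos] at h2
    refine hβn.trans (ENNReal.coe_le_coe.2 (le_add_of_nonneg_of_le bot_le ?_))
    rw [← NNReal.coe_le_coe, Real.coe_toNNReal _ (tsum_nonneg fun n => hf0 n r)]
    refine le_trans (le_of_eq ?_) ((hfs r).le_tsum n fun k _ => hf0 k r)
    have h3 : 1 ≤ (r : ℝ) / δ n := by
      rw [one_le_div (hδ' n)]
      exact NNReal.coe_le_coe.2 (Nat.find_spec hex)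
    simp only [hf]
    rw [min_eq_left h3]
    push_cast
    ring
  · push Not at hex
    have hlim : Tendsto (fun n : ℕ => ((M * (1 / 2) ^ (n + 1) : ℝ≥0) : ℝ≥0∞)) atTop (𝓝 0) := by
      rw [← ENNReal.coe_zero, ENNReal.tendsto_coe]
      have := (tendsto_pow_atTop_nhds_zero_of_lt_one (r := (1 / 2 : ℝ≥0)) bot_le
        (by rw [← NNReal.coe_lt_coe]; norm_num)).const_mul M
      rw [mul_zero] at this
      exact this.comp (tendsto_add_atTop_nat 1)
    exact (ge_of_tendsto' hlim fun n => hβδ n r (hex n)).trans bot_le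

section Gain

variable {X : Type*} [NormedAddCommGroup X] [InnerProductSpace ℝ X] [CompleteSpace X]
  {U : Type*} [NormedAddCommGroup U] [NormedSpace ℝ U]
  {E : C0Semigroup X} {g : X → X} {ω ω' C r₀ : ℝ}

/-- All disturbed trajectories eventually stay in a common ball. -/
lemma IsDissipative.exists_forall_eventually_norm_le (d : IsDissipative E g ω ω' C)
    (h : U →L[ℝ] X) (x₀ : X) : ∃ T, 0 ≤ T ∧ ∀ u ∈ inputSpace U r₀, ∀ t, T ≤ t →
      ‖solSemiprocess E g h u t 0 x₀‖ ≤ absorbRadius (ω - ω') C (‖h‖ * r₀) := by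
  obtain ⟨T, hT, hT'⟩ := d.exists_absorb (‖h‖ * r₀) ‖x₀‖
  exact ⟨T, hT, fun u hu t ht => hT' _ (isForcing_input_of_mem h hu) x₀ le_rfl t ht⟩

/-- Small disturbances keep the trajectories asymptotically close to the attractor: compare, over a
time span in which the attractor attracts the absorbing ball, with the undisturbed trajectory. -/
lemma IsDissipative.exists_limsup_le (d : IsDissipative E g ω ω' C) (h : U →L[ℝ] X)
    (hr₀ : 0 ≤ r₀) {Θ : Set X} (hΘ : IsGlobalAttractor (solSemiprocess E g h) {0} Θ)
    {ε : ℝ≥0} (hε : 0 < ε) :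
    ∃ δ : ℝ≥0, 0 < δ ∧ ∀ u ∈ inputSpace U r₀, ‖u‖₊ < δ → ∀ x₀,
      limsup (fun t : ℝ => Metric.infEDist (solSemiprocess E g h u t 0 x₀) Θ) atTop ≤ ε := by
  set R₀ := absorbRadius (ω - ω') C (‖h‖ * r₀) with hR₀
  have hε2 : (0 : ℝ≥0∞) < ((ε / 2 : ℝ≥0) : ℝ≥0∞) := by
    rw [ENNReal.coe_pos]; positivity
  obtain ⟨T, hT0, hT⟩ := (((hΘ.attractive (Metric.closedBall 0 R₀)
    Metric.isBounded_closedBall).eventually (ge_mem_nhds hε2)).and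
      (eventually_ge_atTop 0)).exists.imp fun T hT => hT.symm
  obtain ⟨k, hk, hkl⟩ := d.exists_norm_sol_sub_le (‖h‖ * r₀) R₀ T hT0
  lift k to ℝ≥0 using hk
  set δ : ℝ≥0 := ε / 2 / (k * ‖h‖₊ + 1) with hδ
  have hδk : k * (‖h‖ * δ) ≤ ε / 2 := by
    have h1 : (δ : ℝ) * (k * ‖h‖ + 1) = ε / 2 := by
      rw [hδ]; push_cast; field_simp
    nlinarith [δ.coe_nonneg]
  refine ⟨δ, by positivity, fun u hu huδ x₀ => ?_⟩
  obtain ⟨T₁, hT₁, habs⟩ := d.exists_forall_eventually_norm_le (r₀ := r₀) h x₀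
  refine limsup_le_of_le (h := ?_)
  filter_upwards [eventually_ge_atTop (T₁ + T)] with t ht
  set c : ℝ≥0 := (t - T).toNNReal with hc
  have hct : (c : ℝ) = t - T := Real.coe_toNNReal _ (by linarith)
  set y := solSemiprocess E g h u (t - T) 0 x₀ with hy
  have hyR : ‖y‖ ≤ R₀ := habs u hu _ (by linarith)
  -- The disturbed trajectory, restarted from `y` at time `t - T`.
  have hxt : solSemiprocess E g h u t 0 x₀ = solSemiprocess E g h (shift c u) T 0 y := by
    rw [← d.solSemiprocess_translate h u c le_rfl hT0, hct]
    have := d.sol_trans (isForcing_input h u) (r := 0) (s := t - T) (t := t) le_rfl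
      (by linarith) (by linarith) x₀
    rw [zero_add, add_sub_cancel]
    exact this.symm
  have hclose : ‖solSemiprocess E g h (shift c u) T 0 y - solSemiprocess E g h 0 T 0 y‖
      ≤ ε / 2 := by
    have h0 : (0 : LInfty U) ∈ Metric.closedBall (0 : LInfty U) r₀ := by simpa using hr₀
    have hw0 : IsForcing (fun r => h ((0 : LInfty U) r)) (‖h‖ * r₀) := by
      refine (isForcing_input h (0 : LInfty U)).mono ?_
      rw [norm_zero, mul_zero]; positivity
    have hm : ‖shift c u‖ ≤ δ := (norm_shift_le c u).trans (NNReal.coe_le_coe.2 huδ.le)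
    have := hkl _ _ (isForcing_input_of_mem h (mapsTo_shift_inputSpace c r₀ hu)) hw0 y y hyR hyR
      (‖h‖ * δ) (by positivity) (by
        have h0 : ((0 : LInfty U) : ℝ → U) =ᵐ[halfLine] 0 := Lp.coeFn_zero U ∞ halfLine
        filter_upwards [h0, ae_norm_le_norm_lInfty (shift c u)] with r hr1 hr2
        rw [hr1, Pi.zero_apply, map_zero, sub_zero]
        exact h.le_opNorm_of_le (hr2.trans hm))
    rw [sub_self, norm_zero, zero_add] at this
    exact this.trans hδk
  rw [hxt]
  refine (Metric.infEDist_le_edist_add_infEDist (y := solSemiprocess E g h 0 T 0 y)).trans ?_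
  have e1 : edist (solSemiprocess E g h (shift c u) T 0 y) (solSemiprocess E g h 0 T 0 y)
      ≤ ((ε / 2 : ℝ≥0) : ℝ≥0∞) := by
    rw [edist_nndist, ENNReal.coe_le_coe, ← NNReal.coe_le_coe, coe_nndist, dist_eq_norm]
    simpa using hclose
  have e2 : Metric.infEDist (solSemiprocess E g h 0 T 0 y) Θ ≤ ((ε / 2 : ℝ≥0) : ℝ≥0∞) :=
    le_trans (le_iSup₂_of_le (f := fun x _ => Metric.infEDist x Θ) _
      ⟨0, rfl, y, by simpa using hyR, rfl⟩ le_rfl) hT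
  refine (add_le_add e1 e2).trans (le_of_eq ?_)
  rw [← ENNReal.coe_add, add_halves]

/-- The attractor is nonempty, because the distance of a trajectory to it is eventually finite. -/
lemma IsGlobalAttractor.nonempty {X V : Type*} [NormedAddCommGroup X] {S : V → ℝ → ℝ → X → X}
    {v : V} {Θ : Set X} (h : IsGlobalAttractor S {v} Θ) : Θ.Nonempty := by
  rw [nonempty_iff_ne_empty]
  rintro rfl
  obtain ⟨t, ht⟩ := ((h.attractive {0} Bornology.isBounded_singleton).eventually
    (gt_mem_nhds zero_lt_one)).exists
  refine absurd ht (not_lt.2 (le_iSup₂_of_le (S v t 0 0) ⟨v, rfl, 0, rfl, rfl⟩ ?_))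
  rw [Metric.infEDist_empty]
  exact le_top

lemma IsDissipative.hasAsymptoticGain (d : IsDissipative E g ω ω' C) (h : U →L[ℝ] X)
    (hr₀ : 0 ≤ r₀) {Θ : Set X} (hΘ : IsGlobalAttractor (solSemiprocess E g h) {0} Θ) :
    HasAsymptoticGain (solSemiprocess E g h) (inputSpace U r₀) Θ := by
  set β : ℝ≥0 → ℝ≥0∞ := fun r => ⨆ u ∈ {u ∈ inputSpace U r₀ | ‖u‖₊ = r}, ⨆ x₀ : X,
    limsup (fun t : ℝ => Metric.infEDist (solSemiprocess E g h u t 0 x₀) Θ) atTop with hβ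
  obtain ⟨θ, hθ⟩ := hΘ.nonempty
  set R₀ := absorbRadius (ω - ω') C (‖h‖ * r₀) with hR₀
  have hR₀' : 0 ≤ R₀ := Real.sqrt_nonneg _
  have hβM : ∀ r, β r ≤ (R₀.toNNReal + ‖θ‖₊ + 1 : ℝ≥0) := by
    refine fun r => iSup₂_le fun u hu => iSup_le fun x₀ => ?_
    obtain ⟨T, -, hT⟩ := d.exists_forall_eventually_norm_le (r₀ := r₀) h x₀
    refine limsup_le_of_le (h := ?_)
    filter_upwards [eventually_ge_atTop T] with t ht
    refine (Metric.infEDist_le_edist_of_mem hθ).trans ?_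
    rw [edist_nndist, ENNReal.coe_le_coe, ← NNReal.coe_le_coe, coe_nndist, dist_eq_norm]
    have h1 := hT u hu.1 t ht
    have h2 := norm_sub_le (solSemiprocess E g h u t 0 x₀) θ
    push_cast
    rw [Real.coe_toNNReal _ hR₀']
    linarith
  have hβ0 : ∀ ε : ℝ≥0, 0 < ε → ∃ δ : ℝ≥0, 0 < δ ∧ ∀ r, r < δ → β r ≤ ε := by
    intro ε hε
    obtain ⟨δ, hδ, hδ'⟩ := d.exists_limsup_le h hr₀ hΘ hε
    refine ⟨δ, hδ, fun r hr => iSup₂_le fun u hu => iSup_le fun x₀ => hδ' u hu.1 ?_ x₀⟩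
    rw [hu.2]
    exact hr
  obtain ⟨γ, hγ, hβγ⟩ := exists_isClassK (by positivity) hβM hβ0
  refine ⟨γ, hγ, fun x₀ u hu => le_trans ?_ (hβγ ‖u‖₊)⟩
  exact le_iSup₂_of_le (f := fun u _ => ⨆ x₀ : X, limsup (fun t : ℝ =>
    Metric.infEDist (solSemiprocess E g h u t 0 x₀) Θ) atTop) u ⟨hu, rfl⟩
    (le_iSup (fun x₀ : X => limsup (fun t : ℝ =>
      Metric.infEDist (solSemiprocess E g h u t 0 x₀) Θ) atTop) x₀)

end Gain

end AsympGain

theorem mainTheorem5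
    {X : Type*} [NormedAddCommGroup X] [InnerProductSpace ℝ X] [CompleteSpace X]
    {U : Type*} [NormedAddCommGroup U] [InnerProductSpace ℝ U] [CompleteSpace U]
    [TopologicalSpace.SeparableSpace U]
    (A : X →ₗ.[ℝ] X) (E : AsympGain.C0Semigroup X) (hA : E.IsGeneratedBy A)
    (hE : E.IsCompactSemigroup)
    (g : X → X) (hg : AsympGain.LipschitzOnBounded g)
    (h : U →L[ℝ] X)
    (ω ω' C : ℝ) (hω : 0 < ω) (hω' : ω' < ω)
    (hdecay : ∀ t : ℝ≥0, ‖E.op t‖ ≤ Real.exp (-ω * t))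
    (hdamp : ∀ x : X, inner ℝ x (g x) ≤ C + ω' * ‖x‖ ^ 2)
    (r₀ : ℝ) (hr₀ : 0 ≤ r₀) :
    ∃ S : AsympGain.LInfty U → ℝ → ℝ → X → X,
      AsympGain.GivenByMildSolutions E g h (AsympGain.inputSpace U r₀) S ∧
      AsympGain.IsSemiprocessFamily (AsympGain.inputSpace U r₀) AsympGain.shift S ∧
      ∃ Θ : Set X, AsympGain.IsGlobalAttractor S {0} Θ ∧
        (∀ Θ' : Set X, AsympGain.IsGlobalAttractor S {0} Θ' → Θ' = Θ) ∧
        AsympGain.HasAsymptoticGain S (AsympGain.inputSpace U r₀) Θ := by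
  have d : AsympGain.IsDissipative E g ω ω' C := ⟨hg, hω, hω', hdecay, hdamp⟩
  obtain ⟨Θ, hΘ⟩ := d.exists_isGlobalAttractor hE h
  exact ⟨AsympGain.solSemiprocess E g h, d.givenByMildSolutions h _, d.isSemiprocessFamily h r₀,
    Θ, hΘ, fun Θ' hΘ' => hΘ'.eq hΘ, d.hasAsymptoticGain h hr₀ hΘ⟩
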